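/- **Setting.** A *marked plumbing graph* $\Gamma_{v_0}$ is a finite tree with a distinguished unweighted vertex $v_0$ and integer weights $m=(m_1,\dots,m_s)$ on the other vertices $v_1,\dots,v_s$. Let $\delta_0,\dots,\delta_s$ be the degrees of the vertices in this tree, let $\Gamma=\Gamma_{v_0}\setminus\{v_0\}$ be the ambient graph, $M$ its adjacency matrix with the weights $m_i$ on the diagonal, $u=(1,\dots,1)\in\mathbb Z^s$, and $\lambda\in\{0,1\}^s$ the indicator of the neighbours of $v_0$. $\Gamma_{v_0}$ is *negative definite* if $M$ is. Put $\mathrm{Char}(\Gamma)=m+2\mathbb Z^s$ and $\mathrm{spin}^c(\Gamma)=(m+2\mathbb Z^s)/2M\mathbb Z^s$; a class $[k]$ is also regarded as the set $k+2M\mathbb Z^s$. **Roots.** For $K\in\mathrm{Char}(\Gamma)$ let $h_U(K)=\frac{K^{T}M^{-1}K+s}{4}$ and $h_V(K)=h_U(K+2\lambda)$. For $i\in 2\mathbb Z+h_U(k)$ and $j\in 2\mathbb Z+h_V(k)$ let $\mathcal S_i=\{K\in[k]: h_U(K)\ge i\}$ and $\mathcal S_{i,j}=\{K\in\mathcal S_i: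 h_V(K)\ge j\}$, regarded as graphs in which $K$ and $K\pm2Me_l$ are adjacent. The graded root has as nodes in grading $i$ the connected components of $\mathcal S_i$, with an edge between $C$ in grading $i$ and $C'$ in grading $i-2$ whenever $C\subseteq C'$. The bigraded root has as nodes in bigrading $(i,j)$ the connected components of $\mathcal S_{i,j}$, with an edge between $C$ in bigrading $(i,j)$ and $C'$ in bigrading $(i-2,j)$ or $(i,j-2)$ whenever $C\subseteq C'$. **Weights.** Let $\mathcal R$ be a commutative ring. A family $W=\{W_n:\mathbb Z\to\mathcal R\}_{n\ge0}$ is *admissible* if $W_2(0)=1$, $W_2(i)=0$ for $i\ne0$, and $W_n(i+1)-W_n(i-1)=W_{n-1}(i)$ for all $n\ge1$, $i\in\mathbb Z$. Fix such a $W$ and $\varepsilon\in\{\pm1\}$. For $K\in\mathrm{Char}(\Gamma)$ let $W_{\Gamma_{v_0}}(K)=\prod_{i=1}^sW_{\delta_i}\big((K-\varepsilon(Mu+\lambda))_i\big)$ and $$\xi(K)=-\tfrac{3s+\sum_{i=0}^s\delta_i+2\sum_{i=1}^s m_i+2\lambda^TM^{-1}\lambda}{4}-\tfrac{K^TM^{-1}K}{4}+\tfrac{\varepsilon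 K^TM^{-1}\lambda}{2}+\tfrac{\varepsilon K^Tu}{2},$$ $$\zeta(K)=\lambda^TM^{-1}K-\varepsilon\lambda^TM^{-1}\lambda-\varepsilon\delta_0,\qquad \theta(K)=\tfrac{K^Tu-\varepsilon\sum_{i=1}^s(\delta_i+m_i)}{2}.$$ The weight of a component $C$ of $\mathcal S_i$ is the formal sum of monomials (with rational exponents, coefficients in $\mathcal R$) $$(t^{-1/2}z-t^{1/2}z^{-1})^{1-\delta_0}\sum_{K\in C}W_{\Gamma_{v_0}}(K)\,q^{\xi(K)}z^{\zeta(K)}t^{\theta(K)},$$ where $(t^{-1/2}z-t^{1/2}z^{-1})^{2-n}:=\sum_{j\in\mathbb Z}W_n(-j)\,z^jt^{-j/2}$. The weight of a component $C$ of $\mathcal S_{i,j}$ in the bigraded root is the weight of the component of $\mathcal S_i$ that contains $C$. The graded root and the bigraded root with these weights are denoted $R_\varepsilon(\Gamma_{v_0},[k],W)$ and $R^{\rm bi}_\varepsilon(\Gamma_{v_0},[k],W)$. **Moves.** Each Neumann move $\Gamma_{v_0}\to\Gamma'_{v_0}$ adds one new unmarked vertex $v_{s+1}$ of weight $-1$.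 (A) subdivides an edge between two unmarked vertices $v_1,v_2$ by $v_{s+1}$ and lowers $m_1$ and $m_2$ by $1$; (A0) subdivides an edge between $v_0$ and an unmarked vertex $v_1$ by $v_{s+1}$ and lowers $m_1$ by $1$; (B) attaches $v_{s+1}$ as a leaf to an unmarked vertex $v_1$ and lowers $m_1$ by $1$; (B0) attaches $v_{s+1}$ as a leaf to $v_0$. (The vertices involved are placed first in the ordering.) The associated map $\beta:\mathrm{spin}^c(\Gamma)\to\mathrm{spin}^c(\Gamma')$ is $\beta([k])=[(k,0)+(-1,-1,0,\dots,0,1)]$ for (A), $\beta([k])=[(k,0)+(-1,0,\dots,0,1)]$ for (A0) and (B), and $\beta([k])=[(k,-1)]$ for (B0). **Theorem.** Let $\Gamma'_{v_0}$ be obtained from the marked plumbing graph $\Gamma_{v_0}$ by one of the moves (A), (A0), (B), (B0), and suppose that one of the two graphs is negative definite. Then both are negative definite, $\beta$ is a bijection, and for every $[k]\in\mathrm{spin}^c(\Gamma)$, every commutative ring $\mathcal R$, every admissible family $W$ with values in $\mathcal R$ and every $\varepsilon\in\{\pm1\}$ there are graph isomorphisms $$R_\varepsilon(\Gamma_{v_0},[k],W)\cong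 R_\varepsilon(\Gamma'_{v_0},\beta([k]),W),\qquad R^{\rm bi}_\varepsilon(\Gamma_{v_0},[k],W)\cong R^{\rm bi}_\varepsilon(\Gamma'_{v_0},\beta([k]),W)$$ preserving the gradings (respectively bigradings) and the weights. -/

import Mathlib

open Matrix

/-! ### Two operations on trees -/

/-- The inclusion of the old vertices (the marked vertex `none` and the unmarked vertices) into
the vertex set with one additional unmarked vertex `some none`. -/
def oldVertex (V : Type*) : Option V ↪ Option (Option V) :=
  Function.Embedding.optionMap Function.Embedding.some

/-- Subdivide the edge `ab`: it is replaced by two edges meeting at the new vertex `some none`. -/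
def subdivide {V : Type*} (G : SimpleGraph (Option V)) (a b : Option V) :
    SimpleGraph (Option (Option V)) :=
  (G.deleteEdges {s(a, b)}).map (oldVertex V) ⊔ SimpleGraph.edge (some none) (oldVertex V a) ⊔
    SimpleGraph.edge (some none) (oldVertex V b)

/-- Attach the new vertex `some none` as a leaf to the vertex `a`. -/
def attachLeaf {V : Type*} (G : SimpleGraph (Option V)) (a : Option V) :
    SimpleGraph (Option (Option V)) :=
  G.map (oldVertex V) ⊔ SimpleGraph.edge (some none) (oldVertex V a)

theorem oldVertex_none {V : Type*} : oldVertex V none = none := rfl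

theorem oldVertex_some {V : Type*} (v : V) : oldVertex V (some v) = some (some v) := rfl

theorem oldVertex_ne_new {V : Type*} (x : Option V) : oldVertex V x ≠ some none := by
  cases x <;> simp [oldVertex_none, oldVertex_some]

theorem subdivide_adj_new {V : Type*} (G : SimpleGraph (Option V)) (a b y : Option V) :
    (subdivide G a b).Adj (some none) (oldVertex V y) ↔ y = a ∨ y = b := by
  have h := oldVertex_ne_new (V := V)
  simp [subdivide, SimpleGraph.edge_adj, SimpleGraph.map_adj, h, (h _).symm]

theorem subdivide_adj_old {V : Type*} (G : SimpleGraph (Option V)) (a b x y : Option V) :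
    (subdivide G a b).Adj (oldVertex V x) (oldVertex V y) ↔ G.Adj x y ∧ s(x, y) ≠ s(a, b) := by
  have h := oldVertex_ne_new (V := V)
  simp [subdivide, SimpleGraph.edge_adj, h, SimpleGraph.deleteEdges_adj]

theorem attachLeaf_adj_new {V : Type*} (G : SimpleGraph (Option V)) (a y : Option V) :
    (attachLeaf G a).Adj (some none) (oldVertex V y) ↔ y = a := by
  have h := oldVertex_ne_new (V := V)
  simp [attachLeaf, SimpleGraph.edge_adj, SimpleGraph.map_adj, h, (h _).symm]

theorem attachLeaf_adj_old {V : Type*} (G : SimpleGraph (Option V)) (a x y : Option V) :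
    (attachLeaf G a).Adj (oldVertex V x) (oldVertex V y) ↔ G.Adj x y := by
  have h := oldVertex_ne_new (V := V)
  simp [attachLeaf, SimpleGraph.edge_adj, h]

theorem connected_of_old {V : Type*} (G : SimpleGraph (Option V)) (hG : G.Connected)
    (H : SimpleGraph (Option (Option V))) (a : Option V)
    (h : ∀ x y, G.Adj x y → H.Reachable (oldVertex V x) (oldVertex V y))
    (ha : H.Adj (some none) (oldVertex V a)) : H.Connected := by
  have key0 : ∀ x y, G.Reachable x y → H.Reachable (oldVertex V x) (oldVertex V y) := by
    rintro x y ⟨p⟩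
    clear ha
    induction p with
    | nil => exact SimpleGraph.Reachable.refl _
    | cons huv _ ih => exact (h _ _ huv).trans ih
  have key : ∀ x, H.Reachable (oldVertex V a) (oldVertex V x) := fun x =>
    key0 a x (hG.preconnected a x)
  rw [SimpleGraph.connected_iff_exists_forall_reachable]
  refine ⟨oldVertex V a, fun y => ?_⟩
  match y with
  | none => exact key none
  | some none => exact ha.reachable.symm
  | some (some v) => exact key (some v)

theorem isTree_of_card {V : Type*} [Finite V] (G : SimpleGraph (Option V)) (hG : G.IsTree)
    (H : SimpleGraph (Option (Option V))) (hH : H.Connected)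
    (hc : H.edgeSet.ncard ≤ G.edgeSet.ncard + 1) : H.IsTree := by
  rw [SimpleGraph.isTree_iff_connected_and_card] at hG ⊢
  refine ⟨hH, ?_⟩
  have h1 := hH.card_vert_le_card_edgeSet_add_one
  have h2 := hG.2
  simp only [Finite.card_option, Nat.card_coe_set_eq] at *
  omega

theorem subdivide_isTree {V : Type*} [Finite V] {G : SimpleGraph (Option V)} (hG : G.IsTree)
    {a b : Option V} (hab : G.Adj a b) : (subdivide G a b).IsTree := by
  have ha : (subdivide G a b).Adj (some none) (oldVertex V a) := by
    simp [subdivide, SimpleGraph.edge_adj, (oldVertex_ne_new a).symm]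
  have hb : (subdivide G a b).Adj (some none) (oldVertex V b) := by
    simp [subdivide, SimpleGraph.edge_adj, (oldVertex_ne_new b).symm]
  refine isTree_of_card G hG _ (connected_of_old G hG.connected _ a ?_ ha) ?_
  · intro x y hxy
    by_cases h : s(x, y) = s(a, b)
    · rw [Sym2.eq_iff] at h
      rcases h with ⟨rfl, rfl⟩ | ⟨rfl, rfl⟩
      · exact ha.reachable.symm.trans hb.reachable
      · exact hb.reachable.symm.trans ha.reachable
    · refine SimpleGraph.Adj.reachable ?_
      refine Or.inl (Or.inl ?_)
      rw [SimpleGraph.map_adj]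
      exact ⟨x, y, by simpa [SimpleGraph.deleteEdges_adj, hxy] using h, rfl, rfl⟩
  · have hsub : (subdivide G a b).edgeSet ⊆
        (oldVertex V).sym2Map '' (G.edgeSet \ {s(a, b)}) ∪ {s(some none, oldVertex V a)} ∪
          {s(some none, oldVertex V b)} := by
      unfold subdivide
      rw [SimpleGraph.edgeSet_sup, SimpleGraph.edgeSet_sup, SimpleGraph.edgeSet_map,
        SimpleGraph.edgeSet_deleteEdges]
      refine Set.union_subset_union (Set.union_subset_union le_rfl ?_) ?_ <;>
      · simp only [SimpleGraph.edge, SimpleGraph.edgeSet_fromEdgeSet]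
        exact Set.sdiff_subset
    have hmem : s(a, b) ∈ G.edgeSet := hab
    have h0 := Set.ncard_le_ncard hsub (Set.toFinite _)
    have h1 := Set.ncard_union_le
      ((oldVertex V).sym2Map '' (G.edgeSet \ {s(a, b)}) ∪ {s(some none, oldVertex V a)})
      {s(some none, oldVertex V b)}
    have h2 := Set.ncard_union_le ((oldVertex V).sym2Map '' (G.edgeSet \ {s(a, b)}))
      {s(some none, oldVertex V a)}
    have h3 := Set.ncard_image_le (f := (oldVertex V).sym2Map)
      (Set.toFinite (G.edgeSet \ {s(a, b)}))
    have h4 := Set.ncard_sdiff_singleton_add_one hmem (Set.toFinite _)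
    simp only [Set.ncard_singleton] at h1 h2
    omega

theorem attachLeaf_isTree {V : Type*} [Finite V] {G : SimpleGraph (Option V)} (hG : G.IsTree)
    (a : Option V) : (attachLeaf G a).IsTree := by
  have ha : (attachLeaf G a).Adj (some none) (oldVertex V a) := by
    simp [attachLeaf, SimpleGraph.edge_adj, (oldVertex_ne_new a).symm]
  refine isTree_of_card G hG _ (connected_of_old G hG.connected _ a ?_ ha) ?_
  · intro x y hxy
    refine SimpleGraph.Adj.reachable (Or.inl ?_)
    rw [SimpleGraph.map_adj]
    exact ⟨x, y, hxy, rfl, rfl⟩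
  · have hsub : (attachLeaf G a).edgeSet ⊆
        (oldVertex V).sym2Map '' G.edgeSet ∪ {s(some none, oldVertex V a)} := by
      unfold attachLeaf
      rw [SimpleGraph.edgeSet_sup, SimpleGraph.edgeSet_map]
      refine Set.union_subset_union le_rfl ?_
      simp only [SimpleGraph.edge, SimpleGraph.edgeSet_fromEdgeSet]
      exact Set.sdiff_subset
    have h0 := Set.ncard_le_ncard hsub (Set.toFinite _)
    have h1 := Set.ncard_union_le ((oldVertex V).sym2Map '' G.edgeSet)
      {s(some none, oldVertex V a)}
    have h3 := Set.ncard_image_le (f := (oldVertex V).sym2Map) (Set.toFinite G.edgeSet)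
    simp only [Set.ncard_singleton] at h1
    omega

/-! ### Marked plumbing trees and their lattices -/

/-- A marked plumbing graph with set of unmarked vertices `V`: a tree on `Option V`, whose vertex
`none` is the marked vertex `v₀`, and integer weights on the unmarked vertices. The ambient
plumbing graph is the weighted forest obtained by deleting `none`. -/
structure MarkedPlumbing (V : Type*) where
  graph : SimpleGraph (Option V)
  isTree : graph.IsTree
  weight : V → ℤ

namespace MarkedPlumbing

section Basic

variable {V : Type*} (Γ : MarkedPlumbing V)

/-- The degree of a vertex (marked or not) in the marked tree. -/
noncomputable def deg (x : Option V) : ℕ := (Γ.graph.neighborSet x).ncard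

open Classical in
/-- The adjacency matrix `M` of the ambient plumbing graph. -/
noncomputable def M : Matrix V V ℤ := fun i j =>
  if i = j then Γ.weight i else if Γ.graph.Adj (some i) (some j) then 1 else 0

open Classical in
/-- The vector `λ`: the indicator of the neighbours of the marked vertex. -/
noncomputable def lam : V → ℤ := fun i => if Γ.graph.Adj none (some i) then 1 else 0

/-- Negative definiteness of the ambient intersection form. -/
def NegDef : Prop := (-(Γ.M.map (Int.cast : ℤ → ℝ))).PosDef

/-- Characteristic vectors: `m + 2 ℤ^s`. -/
def Char : Set (V → ℤ) := {K | ∃ x : V → ℤ, K = Γ.weight + 2 • x}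

variable [Fintype V]

/-- Two characteristic vectors are equivalent if they differ by an element of `2 M ℤ^s`. -/
def spincSetoid : Setoid Γ.Char where
  r K K' := ∃ x : V → ℤ, K'.1 = K.1 + 2 • (Γ.M *ᵥ x)
  iseqv :=
    { refl := fun K => ⟨0, by simp⟩
      symm := by
        rintro K K' ⟨x, hx⟩
        exact ⟨-x, by rw [hx, Matrix.mulVec_neg]; simp⟩
      trans := by
        rintro K K' K'' ⟨x, hx⟩ ⟨y, hy⟩
        exact ⟨x + y, by rw [hy, hx, Matrix.mulVec_add, smul_add, add_assoc]⟩ }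

/-- The spin^c structures of the ambient graph: `(m + 2 ℤ^s) / 2 M ℤ^s`. -/
def Spinc : Type _ := Quotient Γ.spincSetoid

variable {Γ} in
/-- A spin^c structure `[k]` as the set `{k + 2 M x}` of characteristic vectors. -/
def Spinc.lattice (k : Γ.Spinc) : Set (V → ℤ) :=
  {K | ∃ hK : K ∈ Γ.Char, Quotient.mk Γ.spincSetoid ⟨K, hK⟩ = k}

variable [DecidableEq V]

/-- The rational pairing `xᵀ M⁻¹ y`. -/
noncomputable def pair (x y : V → ℤ) : ℚ :=
  (fun v => (x v : ℚ)) ⬝ᵥ ((Γ.M.map (Int.cast : ℤ → ℚ))⁻¹ *ᵥ (fun v => (y v : ℚ)))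

noncomputable def hU (K : V → ℤ) : ℚ := (Γ.pair K K + Fintype.card V) / 4

noncomputable def hV (K : V → ℤ) : ℚ := Γ.hU (K + 2 • Γ.lam)

end Basic

end MarkedPlumbing

/-! ### Weighted graded graphs -/

/-- A graph whose nodes carry a grading in `D` and a weight in `X`. -/
structure WeightedGradedGraph (D X : Type*) where
  Node : Type*
  graph : SimpleGraph Node
  grade : Node → D
  weight : Node → X

/-- Graph isomorphisms that respect gradings and weights. -/
def WeightedGradedGraph.Isomorphic {D X : Type*} (R R' : WeightedGradedGraph D X) : Prop :=
  ∃ f : R.graph ≃g R'.graph,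
    (∀ n, R'.grade (f n) = R.grade n) ∧ (∀ n, R'.weight (f n) = R.weight n)

/-! ### Admissible families and formal series -/

structure Admissible {R : Type*} [CommRing R] (W : ℕ → ℤ → R) : Prop where
  two_zero : W 2 0 = 1
  two_ne : ∀ i : ℤ, i ≠ 0 → W 2 i = 0
  step : ∀ n : ℕ, 1 ≤ n → ∀ i : ℤ, W n (i + 1) - W n (i - 1) = W (n - 1) i

/-- Formal sums of monomials `z^a q^b t^c` with rational exponents and coefficients in `R`, given
by the coefficient function `(a, b, c) ↦ R`. -/
abbrev Series3 (R : Type*) := ℚ → ℚ → ℚ → R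

/-- The expansion `(t^{-1/2} z - t^{1/2} z⁻¹)^{2-n} = ∑_{j ∈ ℤ} W_n(-j) z^j t^{-j/2}`. -/
def expansion {R : Type*} [CommRing R] (W : ℕ → ℤ → R) (n : ℕ) : Series3 R := fun a b c =>
  if a.den = 1 ∧ b = 0 ∧ c = -a / 2 then W n (-a.num) else 0

namespace MarkedPlumbing

section Roots

variable {V : Type*} [Fintype V] [DecidableEq V] (Γ : MarkedPlumbing V)

/-- The graph on lattice points in which `K` and `K ± 2 M e_i` are joined. -/
def latticeGraph : SimpleGraph (V → ℤ) :=
  SimpleGraph.fromRel fun K K' => ∃ i : V, K' = K + 2 • (Γ.M *ᵥ Pi.single i 1)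

/-- `C` is the set of lattice points of a connected component of the one-dimensional complex
spanned by the set `S` of lattice points. -/
def IsComponent (S C : Set (V → ℤ)) : Prop :=
  ∃ c : (Γ.latticeGraph.induce S).ConnectedComponent, C = Subtype.val '' c.supp

variable {Γ} in
/-- The superlevel set of `h_U` at height `i`. -/
def Spinc.superU (k : Γ.Spinc) (i : ℚ) : Set (V → ℤ) := {K | K ∈ k.lattice ∧ i ≤ Γ.hU K}

variable {Γ} in
/-- The superlevel set of `h_V` at height `j`. -/
def Spinc.superV (k : Γ.Spinc) (j : ℚ) : Set (V → ℤ) := {K | K ∈ k.lattice ∧ j ≤ Γ.hV K}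

variable {Γ} in
/-- The set of gradings `2 ℤ + h_U(k)`. -/
def Spinc.gradesU (k : Γ.Spinc) : Set ℚ :=
  {i | ∃ K ∈ k.lattice, ∃ n : ℤ, i = 2 * n + Γ.hU K}

variable {Γ} in
/-- The set of gradings `2 ℤ + h_V(k)`. -/
def Spinc.gradesV (k : Γ.Spinc) : Set ℚ :=
  {j | ∃ K ∈ k.lattice, ∃ n : ℤ, j = 2 * n + Γ.hV K}

/-- The weight of a lattice point, `∏ W_{δ_i}((K - ε(M u + λ))_i)`, where `u = (1, …, 1)`. -/
noncomputable def pointWeight {R : Type*} [CommRing R] (ε : ℤ) (W : ℕ → ℤ → R) (K : V → ℤ) : R :=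
  ∏ i : V, W (Γ.deg (some i)) ((K - ε • (Γ.M *ᵥ (fun _ => 1) + Γ.lam)) i)

/-- The exponent of `q`. -/
noncomputable def xi (ε : ℤ) (K : V → ℤ) : ℚ :=
  -(3 * (Fintype.card V : ℚ) + ∑ x : Option V, (Γ.deg x : ℚ) + 2 * ∑ v : V, (Γ.weight v : ℚ)
      + 2 * Γ.pair Γ.lam Γ.lam) / 4
    - Γ.pair K K / 4 + ε * Γ.pair K Γ.lam / 2 + ε * (∑ v : V, (K v : ℚ)) / 2

/-- The exponent of `z`. -/
noncomputable def zeta (ε : ℤ) (K : V → ℤ) : ℚ :=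
  Γ.pair Γ.lam K - ε * Γ.pair Γ.lam Γ.lam - ε * (Γ.deg none : ℚ)

/-- The exponent of `t`. -/
noncomputable def theta (ε : ℤ) (K : V → ℤ) : ℚ :=
  ((∑ v : V, (K v : ℚ)) - ε * ∑ v : V, ((Γ.deg (some v) : ℚ) + Γ.weight v)) / 2

/-- The three-variable weight of a (finite) set `C` of lattice points,
`(t^{-1/2} z - t^{1/2} z⁻¹)^{1-δ₀} ∑_{K ∈ C} W(K) z^{ζ(K)} q^{ξ(K)} t^{θ(K)}`,
given by its coefficients. -/
noncomputable def componentWeight {R : Type*} [CommRing R] (ε : ℤ) (W : ℕ → ℤ → R)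
    (C : Set (V → ℤ)) : Series3 R := fun a b c =>
  ∑ᶠ K ∈ C, Γ.pointWeight ε W K *
    expansion W (Γ.deg none + 1) (a - Γ.zeta ε K) (b - Γ.xi ε K) (c - Γ.theta ε K)

/-- The weighted graded root of the knot complement: its nodes are the pairs `(i, C)` of a grading
and a component of the superlevel set at `i`, with edges from `(i, C)` to `(i - 2, C')` whenever
`C ⊆ C'`. -/
noncomputable def weightedRoot {R : Type*} [CommRing R] (ε : ℤ) (k : Γ.Spinc) (W : ℕ → ℤ → R) :
    WeightedGradedGraph ℚ (Series3 R) where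
  Node := {n : ℚ × Set (V → ℤ) // n.1 ∈ k.gradesU ∧ Γ.IsComponent (k.superU n.1) n.2}
  graph := SimpleGraph.fromRel fun n n' => n'.1.1 = n.1.1 - 2 ∧ n.1.2 ⊆ n'.1.2
  grade n := n.1.1
  weight n := Γ.componentWeight ε W n.1.2

/-- The weighted bigraded root: its nodes are the triples `(i, j, C)` of a bigrading and a component
of the intersection of the superlevel sets at `i` and `j`, with edges to `(i - 2, j, C')` and
`(i, j - 2, C')` whenever `C ⊆ C'`. The weight of `(i, j, C)` is the weight of the component of
the `h_U`-superlevel set at `i` that contains `C`. -/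
noncomputable def weightedBiroot {R : Type*} [CommRing R] (ε : ℤ) (k : Γ.Spinc) (W : ℕ → ℤ → R) :
    WeightedGradedGraph (ℚ × ℚ) (Series3 R) where
  Node := {n : (ℚ × ℚ) × Set (V → ℤ) // n.1.1 ∈ k.gradesU ∧ n.1.2 ∈ k.gradesV ∧
    Γ.IsComponent (k.superU n.1.1 ∩ k.superV n.1.2) n.2}
  graph := SimpleGraph.fromRel fun n n' =>
    ((n'.1.1.1 = n.1.1.1 - 2 ∧ n'.1.1.2 = n.1.1.2) ∨
      (n'.1.1.1 = n.1.1.1 ∧ n'.1.1.2 = n.1.1.2 - 2)) ∧ n.1.2 ⊆ n'.1.2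
  grade n := n.1.1
  weight n := Γ.componentWeight ε W
    (⋃₀ {D | Γ.IsComponent (k.superU n.1.1.1) D ∧ n.1.2 ⊆ D})

end Roots

/-! ### Neumann moves -/

section Moves

variable {V : Type*} (Γ : MarkedPlumbing V)

/-- The Neumann moves (blow-ups) that can be performed on a marked plumbing graph: `A` and `A0`
at an edge, `B` and `B0` at a vertex; `A0` and `B0` involve the marked vertex. -/
inductive Move where
  | A (v w : V) (h : Γ.graph.Adj (some v) (some w))
  | A0 (v : V) (h : Γ.graph.Adj none (some v))
  | B (v : V)
  | B0

namespace Move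

variable {Γ} [Fintype V] [DecidableEq V]

/-- The vector by which the move changes the weights and the characteristic vectors at the old
unmarked vertices: the indicator of the unmarked vertices adjacent to the new vertex. -/
def support (μ : Γ.Move) : V → ℤ :=
  match μ with
  | .A v w _ => Pi.single v 1 + Pi.single w 1
  | .A0 v _ => Pi.single v 1
  | .B v => Pi.single v 1
  | .B0 => 0

/-- The marked plumbing graph that results from a move. The new vertex has weight `-1`, and the
weights of the unmarked vertices adjacent to it decrease by `1`. -/
def result (μ : Γ.Move) : MarkedPlumbing (Option V) where
  graph :=
    match μ with
    | .A v w _ => subdivide Γ.graph (some v) (some w)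
    | .A0 v _ => subdivide Γ.graph none (some v)
    | .B v => attachLeaf Γ.graph (some v)
    | .B0 => attachLeaf Γ.graph none
  isTree :=
    match μ with
    | .A _ _ h => subdivide_isTree Γ.isTree h
    | .A0 _ h => subdivide_isTree Γ.isTree h
    | .B v => attachLeaf_isTree Γ.isTree (some v)
    | .B0 => attachLeaf_isTree Γ.isTree none
  weight x :=
    match x with
    | none => -1
    | some u => Γ.weight u - μ.support u

/-- The map on characteristic vectors: `(k, 0) + (-1, -1, 0, …, 0, 1)` for `A`,
`(k, 0) + (-1, 0, …, 0, 1)` for `A0` and `B`, and `(k, -1)` for `B0`. -/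
def betaVec (μ : Γ.Move) (k : V → ℤ) : Option V → ℤ := fun x =>
  match x with
  | some u => k u - μ.support u
  | none => match μ with
    | .B0 => -1
    | _ => 1

theorem M_none_none (μ : Γ.Move) : μ.result.M none none = -1 := by
  simp [M, result]

open Classical in
theorem M_none_some (μ : Γ.Move) (u : V) : μ.result.M none (some u) = μ.support u := by
  have e : μ.result.M none (some u) =
      if μ.result.graph.Adj (some none) (oldVertex V (some u)) then 1 else 0 := by
    by_cases h : μ.result.graph.Adj (some none) (some (some u)) <;> simp [M, oldVertex_some, h]
  rw [e]
  cases μ with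
  | A v w h =>
    have hvw : v ≠ w := fun e => h.ne (by rw [e])
    simp only [result, support, subdivide_adj_new, Option.some_inj, Pi.add_apply,
      Pi.single_apply]
    by_cases h1 : u = v <;> by_cases h2 : u = w <;> simp_all
  | A0 v h => simp [result, support, subdivide_adj_new, Pi.single_apply]
  | B v => simp [result, support, attachLeaf_adj_new, Pi.single_apply]
  | B0 => simp [result, support, attachLeaf_adj_new]

theorem M_some_none (μ : Γ.Move) (u : V) : μ.result.M (some u) none = μ.support u := by
  rw [← M_none_some]
  by_cases h : μ.result.graph.Adj (some none) (some (some u))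
  · simp [M, h, h.symm]
  · simpa [M, h] using fun h' : μ.result.graph.Adj (some (some u)) (some none) => h h'.symm

open Classical in
theorem M_some_some (μ : Γ.Move) (a b : V) :
    μ.result.M (some a) (some b) = Γ.M a b - μ.support a * μ.support b := by
  by_cases hab : a = b
  · subst hab
    have hs : μ.support a * μ.support a = μ.support a := by
      cases μ with
      | A v w h =>
        have hvw : v ≠ w := fun e => h.ne (by rw [e])
        simp only [support, Pi.add_apply, Pi.single_apply]
        by_cases h1 : a = v <;> by_cases h2 : a = w <;> simp_all
      | A0 v h => simp [support, Pi.single_apply]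
      | B v => simp [support, Pi.single_apply]
      | B0 => simp [support]
    rw [hs]
    simp [M, result]
  · have e : μ.result.M (some a) (some b) =
        if μ.result.graph.Adj (oldVertex V (some a)) (oldVertex V (some b)) then 1 else 0 := by
      by_cases h : μ.result.graph.Adj (some (some a)) (some (some b)) <;>
        simp [M, oldVertex_some, hab, h]
    rw [e]
    simp only [M, hab, if_false]
    cases μ with
    | A v w h =>
      have hvw : v ≠ w := fun e => h.ne (by rw [e])
      have h' := h.symm
      simp only [result, support, subdivide_adj_old, Pi.add_apply, Pi.single_apply, ne_eq,
        Sym2.eq_iff, Option.some_inj]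
      by_cases h1 : a = v <;> by_cases h2 : a = w <;> by_cases h3 : b = v <;>
        by_cases h4 : b = w <;> simp_all
    | A0 v h =>
      simp only [result, support, subdivide_adj_old, Pi.single_apply, ne_eq, Sym2.eq_iff]
      by_cases h1 : a = v <;> by_cases h3 : b = v <;> simp_all
    | B v =>
      simp only [result, support, attachLeaf_adj_old, Pi.single_apply]
      by_cases h1 : a = v <;> by_cases h3 : b = v <;> simp_all
    | B0 => simp [result, support, attachLeaf_adj_old]

theorem betaVec_mem (μ : Γ.Move) {k : V → ℤ} (hk : k ∈ Γ.Char) :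
    μ.betaVec k ∈ μ.result.Char := by
  obtain ⟨x, rfl⟩ := hk
  cases μ with
  | B0 =>
    refine ⟨fun y => y.elim 0 x, ?_⟩
    funext y
    cases y <;> simp [betaVec, result]; ring
  | _ =>
    refine ⟨fun y => y.elim 1 x, ?_⟩
    funext y
    cases y <;> simp [betaVec, result]; ring

theorem betaVec_add (μ : Γ.Move) (k x : V → ℤ) :
    μ.betaVec (k + 2 • (Γ.M *ᵥ x)) =
      μ.betaVec k + 2 • (μ.result.M *ᵥ fun y => y.elim (μ.support ⬝ᵥ x) x) := by
  funext y
  cases y with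
  | none =>
    have : (μ.result.M *ᵥ fun y => y.elim (μ.support ⬝ᵥ x) x) none = 0 := by
      simp [Matrix.mulVec, dotProduct, Fintype.sum_option, M_none_none, M_none_some]
    simp only [Pi.add_apply, Pi.smul_apply, this]
    cases μ <;> simp [betaVec]
  | some u =>
    have : (μ.result.M *ᵥ fun y => y.elim (μ.support ⬝ᵥ x) x) (some u) = (Γ.M *ᵥ x) u := by
      simp only [Matrix.mulVec, dotProduct, Fintype.sum_option, M_some_none, M_some_some,
        Option.elim, sub_mul, Finset.sum_sub_distrib, Finset.mul_sum]
      simp only [mul_assoc]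
      ring
    simp only [Pi.add_apply, Pi.smul_apply, this, betaVec]
    ring

/-- The induced map `β` on spin^c structures, `β([k]) = [betaVec k]`. -/
def beta (μ : Γ.Move) : Γ.Spinc → μ.result.Spinc :=
  Quotient.map' (s₁ := Γ.spincSetoid) (s₂ := μ.result.spincSetoid)
    (fun K => ⟨μ.betaVec K.1, μ.betaVec_mem K.2⟩) (by
      rintro K K' ⟨x, hx⟩
      exact ⟨_, (congrArg μ.betaVec hx).trans (μ.betaVec_add K.1 x)⟩)

end Move

end Moves

end MarkedPlumbing

/-! Every move is a blow-up, and the new form is the old one plus an orthogonal summand `⟨-1⟩`. Let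
σ be the indicator of the unmarked neighbours of the new vertex (`support`), ℓ = 1 or 0 according to
whether the new vertex meets the marked one (`link`), and e = 1 or 0 for a subdivision or a leaf
(`edgeType`). Then `x'ᵀM'x' = xᵀMx - (x₀ - σ·x)²` (`result_form`), which settles definiteness.
Dually, a vector `K'` is the same as a pair (K, c) of its projection `K = K'|_V + c σ` and its
coordinate c at the new vertex, and the inverse form is `pair(K, K) - c²` (`pair_result`). The class
`β([k])` consists of the pairs with K in [k] and c odd (`mem_lattice_beta`), which gives the
bijection.

Hence h_U changes by (1 - c²)/4 and h_V by (1 - (c + 2ℓ)²)/4. Both are even integers ≤ 0, so the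
gradings agree and superlevel sets project to superlevel sets. The fibres are intervals of odd
numbers, hence connected, and always contain c = -1. Once edges are seen to lift as well, the
projection induces a bijection on components (`IsComponentMap.reachableIn_iff`). Lifting is delicate
only for the bigraded root and ℓ = 1: a lift of an edge may then violate one of the two bounds, but
the changes of h_U and h_V along the edge differ by exactly 2, so one of two candidate lifts always
works (`isComponentMap_superUV`).

For the weights, the new vertex contributes the factor `W (e + 1) (c - ε e)`, which vanishes unless
c = ±1. Over each K at most two points remain, and their terms add up to the term of K
(`term_lift_add`): for a subdivision only c = ε survives; for a leaf the two terms combine through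
the recursion for W, applied at the neighbour for (B) and to the prefactor for (B0). Summing over
the finite set C compares the weights (`componentWeight_result`). -/

/-! ### Components of superlevel sets under a projection -/

namespace SimpleGraph

variable {A B : Type*}

/-- `x` and `y` lie in `S` and are joined by a path inside `S`. -/
def ReachableIn (G : SimpleGraph A) (S : Set A) (x y : A) : Prop :=
  ∃ (hx : x ∈ S) (hy : y ∈ S), (G.induce S).Reachable ⟨x, hx⟩ ⟨y, hy⟩

namespace ReachableIn

variable {G : SimpleGraph A} {S T : Set A} {x y z : A}

theorem refl (hx : x ∈ S) : G.ReachableIn S x x := ⟨hx, hx, Reachable.refl _⟩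

theorem symm (h : G.ReachableIn S x y) : G.ReachableIn S y x := by
  obtain ⟨hx, hy, h⟩ := h
  exact ⟨hy, hx, h.symm⟩

theorem trans (h : G.ReachableIn S x y) (h' : G.ReachableIn S y z) : G.ReachableIn S x z := by
  obtain ⟨hx, hy, h⟩ := h
  obtain ⟨_, hz, h'⟩ := h'
  exact ⟨hx, hz, h.trans h'⟩

theorem of_adj (hx : x ∈ S) (hy : y ∈ S) (h : G.Adj x y) : G.ReachableIn S x y :=
  ⟨hx, hy, Adj.reachable h⟩

theorem left_mem (h : G.ReachableIn S x y) : x ∈ S := h.1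

theorem right_mem (h : G.ReachableIn S x y) : y ∈ S := h.2.1

theorem mono (hST : S ⊆ T) (h : G.ReachableIn S x y) : G.ReachableIn T x y := by
  obtain ⟨hx, hy, h⟩ := h
  exact ⟨hST hx, hST hy, h.map (induceHomOfLE G hST).toHom⟩

/-- A relation that is reflexive, transitive and holds along the edges inside `S` holds between
any two points joined by a path inside `S`. -/
theorem lift {r : A → A → Prop} (hrefl : ∀ x ∈ S, r x x) (htrans : ∀ x y z, r x y → r y z → r x z)
    (hadj : ∀ x ∈ S, ∀ y ∈ S, G.Adj x y → r x y) (h : G.ReachableIn S x y) : r x y := by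
  obtain ⟨hx, hy, ⟨p⟩⟩ := h
  suffices ∀ a b : S, (G.induce S).Walk a b → r a b from this _ _ p
  intro a b p
  induction p with
  | nil => exact hrefl _ (Subtype.prop _)
  | cons hab _ ih => exact htrans _ _ _ (hadj _ (Subtype.prop _) _ (Subtype.prop _) hab) ih

end ReachableIn

/-- A map `f` of vertex sets that carries `S'` to `S`, edges inside `S'` to edges or points, and
is such that the parts of its fibres inside `S'` are connected and that edges inside `S` can be
lifted to `S'`. -/
structure IsComponentMap (G : SimpleGraph A) (G' : SimpleGraph B) (f : B → A) (S : Set A)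
    (S' : Set B) : Prop where
  mapsTo : ∀ x ∈ S', f x ∈ S
  surj : ∀ a ∈ S, ∃ x ∈ S', f x = a
  adj : ∀ x y, G'.Adj x y → f x = f y ∨ G.Adj (f x) (f y)
  fiber : ∀ x ∈ S', ∀ y ∈ S', f x = f y → G'.ReachableIn S' x y
  lift : ∀ a ∈ S, ∀ b ∈ S, G.Adj a b → ∃ x y, f x = a ∧ f y = b ∧ G'.ReachableIn S' x y

/-- Paths project edge by edge. Conversely, a path downstairs is lifted edge by edge; a lifted edge
need not begin where the previous one ended, but both points lie in one fibre, which is connected.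
-/
theorem IsComponentMap.reachableIn_iff {G : SimpleGraph A} {G' : SimpleGraph B} {f : B → A}
    {S : Set A} {S' : Set B} (h : IsComponentMap G G' f S S') {x y : B} (hx : x ∈ S')
    (hy : y ∈ S') : G'.ReachableIn S' x y ↔ G.ReachableIn S (f x) (f y) := by
  constructor
  · refine ReachableIn.lift (r := fun x y => G.ReachableIn S (f x) (f y))
      (fun x hx => .refl (h.mapsTo x hx)) (fun _ _ _ => .trans) fun x hx y hy hxy => ?_
    rcases h.adj x y hxy with e | e
    · rw [← e]
      exact .refl (h.mapsTo x hx)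
    · exact .of_adj (h.mapsTo x hx) (h.mapsTo y hy) e
  · intro hxy
    -- The relation must quantify over all lifts of the starting point in order to be transitive.
    have := ReachableIn.lift (G := G) (S := S)
      (r := fun a b => ∀ x ∈ S', f x = a → ∃ y ∈ S', f y = b ∧ G'.ReachableIn S' x y)
      (fun a _ x hx e => ⟨x, hx, e, .refl hx⟩)
      (fun a b c hab hbc x hx e => by
        obtain ⟨y, hy, ey, hxy⟩ := hab x hx e
        obtain ⟨z, hz, ez, hyz⟩ := hbc y hy ey
        exact ⟨z, hz, ez, hxy.trans hyz⟩)
      (fun a ha b hb hab x hx e => by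
        obtain ⟨x', y', ex, ey, hr⟩ := h.lift a ha b hb hab
        exact ⟨y', hr.right_mem, ey, (h.fiber x hx x' hr.left_mem (e.trans ex.symm)).trans hr⟩)
      hxy
    obtain ⟨z, hz, ez, hxz⟩ := this x hx rfl
    exact hxz.trans (h.fiber z hz y hy ez)

end SimpleGraph

namespace MarkedPlumbing

open SimpleGraph

section Components

variable {V V' : Type*} [Fintype V] [DecidableEq V] [Fintype V'] [DecidableEq V']
  {Γ : MarkedPlumbing V} {Γ' : MarkedPlumbing V'}

theorem isComponent_iff {S C : Set (V → ℤ)} :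
    Γ.IsComponent S C ↔ ∃ x ∈ S, C = {y | Γ.latticeGraph.ReachableIn S x y} := by
  have key : ∀ x : S, Subtype.val '' ((Γ.latticeGraph.induce S).connectedComponentMk x).supp =
      {y | Γ.latticeGraph.ReachableIn S x y} := by
    intro x
    ext y
    constructor
    · rintro ⟨z, hz, rfl⟩
      exact ⟨x.2, z.2, (ConnectedComponent.eq.1 hz).symm⟩
    · rintro ⟨hx, hy, h⟩
      exact ⟨⟨y, hy⟩, ConnectedComponent.eq.2 h.symm, rfl⟩
  constructor
  · rintro ⟨c, rfl⟩
    induction c using ConnectedComponent.ind with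
    | h x => exact ⟨x, x.2, key x⟩
  · rintro ⟨x, hx, rfl⟩
    exact ⟨_, (key ⟨x, hx⟩).symm⟩

theorem IsComponent.subset {S C : Set (V → ℤ)} (h : Γ.IsComponent S C) : C ⊆ S := by
  obtain ⟨x, _, rfl⟩ := isComponent_iff.1 h
  exact fun y hy => hy.right_mem

theorem IsComponent.nonempty {S C : Set (V → ℤ)} (h : Γ.IsComponent S C) : C.Nonempty := by
  obtain ⟨x, hx, rfl⟩ := isComponent_iff.1 h
  exact ⟨x, .refl hx⟩

theorem IsComponent.eq_of_mem {S C D : Set (V → ℤ)} (hC : Γ.IsComponent S C)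
    (hD : Γ.IsComponent S D) {x : V → ℤ} (hxC : x ∈ C) (hxD : x ∈ D) : C = D := by
  obtain ⟨y, _, rfl⟩ := isComponent_iff.1 hC
  obtain ⟨z, _, rfl⟩ := isComponent_iff.1 hD
  ext w
  exact ⟨fun h => (hxD.trans hxC.symm).trans h, fun h => (hxC.trans hxD.symm).trans h⟩

/-- A component of a smaller set lies in a unique component of a larger one. -/
theorem IsComponent.sUnion {S T C : Set (V → ℤ)} (hST : S ⊆ T) (hC : Γ.IsComponent S C) :
    Γ.IsComponent T (⋃₀ {D | Γ.IsComponent T D ∧ C ⊆ D}) ∧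
      C ⊆ ⋃₀ {D | Γ.IsComponent T D ∧ C ⊆ D} := by
  obtain ⟨x, hx, rfl⟩ := isComponent_iff.1 hC
  have h : Γ.IsComponent T {y | Γ.latticeGraph.ReachableIn T x y} :=
    isComponent_iff.2 ⟨x, hST hx, rfl⟩
  have e : {D | Γ.IsComponent T D ∧ {y | Γ.latticeGraph.ReachableIn S x y} ⊆ D} =
      {{y | Γ.latticeGraph.ReachableIn T x y}} := by
    ext D
    constructor
    · rintro ⟨hD, hsub⟩
      exact hD.eq_of_mem h (hsub (.refl hx)) (.refl (hST hx))
    · rintro rfl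
      exact ⟨h, fun y hy => hy.mono hST⟩
  rw [e, Set.sUnion_singleton]
  exact ⟨h, fun y hy => hy.mono hST⟩

variable {f : (V' → ℤ) → V → ℤ} {S : Set (V → ℤ)} {S' : Set (V' → ℤ)}

/-- With the next three lemmas this shows that `C ↦ f ⁻¹' C ∩ S'` and `C ↦ f '' C` are mutually
inverse bijections between components. The intersection is needed because the fibres of `f` may
leave `S'`. -/
theorem IsComponent.preimage
    (h : IsComponentMap Γ.latticeGraph Γ'.latticeGraph f S S') {C : Set (V → ℤ)}
    (hC : Γ.IsComponent S C) : Γ'.IsComponent S' (f ⁻¹' C ∩ S') := by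
  obtain ⟨a, ha, rfl⟩ := isComponent_iff.1 hC
  obtain ⟨x, hx, rfl⟩ := h.surj a ha
  refine isComponent_iff.2 ⟨x, hx, ?_⟩
  ext y
  constructor
  · rintro ⟨hy, hy'⟩
    exact (h.reachableIn_iff hx hy').2 hy
  · intro hy
    exact ⟨(h.reachableIn_iff hx hy.right_mem).1 hy, hy.right_mem⟩

theorem IsComponent.image
    (h : IsComponentMap Γ.latticeGraph Γ'.latticeGraph f S S') {C : Set (V' → ℤ)}
    (hC : Γ'.IsComponent S' C) : Γ.IsComponent S (f '' C) := by
  obtain ⟨x, hx, rfl⟩ := isComponent_iff.1 hC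
  refine isComponent_iff.2 ⟨f x, h.mapsTo x hx, ?_⟩
  ext b
  constructor
  · rintro ⟨y, hy, rfl⟩
    exact (h.reachableIn_iff hx hy.right_mem).1 hy
  · intro hb
    obtain ⟨y, hy, rfl⟩ := h.surj b hb.right_mem
    exact ⟨y, (h.reachableIn_iff hx hy).2 hb, rfl⟩

theorem IsComponent.preimage_image
    (h : IsComponentMap Γ.latticeGraph Γ'.latticeGraph f S S') {C : Set (V' → ℤ)}
    (hC : Γ'.IsComponent S' C) : f ⁻¹' (f '' C) ∩ S' = C := by
  obtain ⟨x, hx, rfl⟩ := isComponent_iff.1 hC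
  ext y
  constructor
  · rintro ⟨⟨z, hz, e⟩, hy⟩
    exact hz.trans (h.fiber z hz.right_mem y hy e)
  · intro hy
    exact ⟨⟨y, hy, rfl⟩, hy.right_mem⟩

theorem IsComponent.image_preimage
    (h : IsComponentMap Γ.latticeGraph Γ'.latticeGraph f S S') {C : Set (V → ℤ)}
    (hC : Γ.IsComponent S C) : f '' (f ⁻¹' C ∩ S') = C := by
  ext a
  constructor
  · rintro ⟨x, ⟨hx, _⟩, rfl⟩
    exact hx
  · intro ha
    obtain ⟨x, hx, rfl⟩ := h.surj a (hC.subset ha)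
    exact ⟨x, ⟨ha, hx⟩, rfl⟩

end Components

end MarkedPlumbing

/-! ### The intersection form -/

namespace MarkedPlumbing

section Form

variable {V : Type*} (Γ : MarkedPlumbing V)

theorem M_symm (i j : V) : Γ.M i j = Γ.M j i := by
  by_cases h : i = j
  · rw [h]
  · by_cases h' : Γ.graph.Adj (some i) (some j)
    · simp [M, h, Ne.symm h, h', h'.symm]
    · simpa [M, h, Ne.symm h, h'] using fun e : Γ.graph.Adj (some j) (some i) => h' e.symm

theorem M_self (i : V) : Γ.M i i = Γ.weight i := by simp [M]

theorem M_transpose : Γ.Mᵀ = Γ.M := by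
  ext i j
  exact Γ.M_symm j i

/-- Lets identities proved over an arbitrary commutative ring be specialised to ℤ. -/
theorem map_intCast_self {V : Type*} (A : Matrix V V ℤ) : A.map (Int.cast : ℤ → ℤ) = A := rfl

variable [Fintype V]

theorem negDef_iff : Γ.NegDef ↔
    ∀ x : V → ℝ, x ≠ 0 → x ⬝ᵥ (Γ.M.map (Int.cast : ℤ → ℝ) *ᵥ x) < 0 := by
  rw [NegDef, Matrix.posDef_iff_dotProduct_mulVec]
  have h : (Γ.M.map (Int.cast : ℤ → ℝ)).IsSymm := by
    ext i j
    simp [Γ.M_symm i j]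
  simp [h, Matrix.neg_mulVec]

variable {Γ}

theorem NegDef.dotProduct_nonpos (h : Γ.NegDef) (x : V → ℚ) :
    x ⬝ᵥ (Γ.M.map (Int.cast : ℤ → ℚ) *ᵥ x) ≤ 0 := by
  rcases eq_or_ne x 0 with rfl | hx
  · simp
  have hx' : (fun v => (x v : ℝ)) ≠ 0 := fun e => hx (by
    funext v
    simpa using congrFun e v)
  have := (Γ.negDef_iff.1 h _ hx').le
  have e : ((x ⬝ᵥ (Γ.M.map (Int.cast : ℤ → ℚ) *ᵥ x) : ℚ) : ℝ) =
      (fun v => (x v : ℝ)) ⬝ᵥ (Γ.M.map (Int.cast : ℤ → ℝ) *ᵥ fun v => (x v : ℝ)) := by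
    simp [dotProduct, Matrix.mulVec]
  rw [← e] at this
  exact_mod_cast this

theorem NegDef.weight_neg [DecidableEq V] (h : Γ.NegDef) (v : V) : Γ.weight v < 0 := by
  have := Γ.negDef_iff.1 h (Pi.single v 1) (by simp)
  simpa [M_self] using this

theorem NegDef.isUnit_det [DecidableEq V] (h : Γ.NegDef) :
    IsUnit (Γ.M.map (Int.cast : ℤ → ℚ)).det := by
  have h1 : IsUnit (-(Γ.M.map (Int.cast : ℤ → ℝ))) := Matrix.PosDef.isUnit h
  rw [IsUnit.neg_iff, Matrix.isUnit_iff_isUnit_det, isUnit_iff_ne_zero] at h1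
  rw [isUnit_iff_ne_zero]
  have e1 : (Γ.M.map (Int.cast : ℤ → ℝ)).det = (Γ.M.det : ℝ) :=
    (RingHom.map_det (Int.castRingHom ℝ) Γ.M).symm
  have e2 : (Γ.M.map (Int.cast : ℤ → ℚ)).det = (Γ.M.det : ℚ) :=
    (RingHom.map_det (Int.castRingHom ℚ) Γ.M).symm
  rw [e1] at h1
  rw [e2]
  exact_mod_cast h1

variable [DecidableEq V]

/-- Pairings are computed from any solution of `M z = y`, so that no inverse matrix has to be
written down. -/
theorem pair_eq (h : Γ.NegDef) {x y : V → ℤ} {z : V → ℚ}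
    (hz : Γ.M.map (Int.cast : ℤ → ℚ) *ᵥ z = fun v => (y v : ℚ)) :
    Γ.pair x y = (fun v => (x v : ℚ)) ⬝ᵥ z := by
  rw [pair, ← hz, Matrix.mulVec_mulVec, Matrix.nonsing_inv_mul _ h.isUnit_det, Matrix.one_mulVec]

theorem exists_solution (h : Γ.NegDef) (y : V → ℤ) :
    ∃ z : V → ℚ, Γ.M.map (Int.cast : ℤ → ℚ) *ᵥ z = fun v => (y v : ℚ) :=
  ⟨(Γ.M.map (Int.cast : ℤ → ℚ))⁻¹ *ᵥ fun v => (y v : ℚ), by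
    rw [Matrix.mulVec_mulVec, Matrix.mul_nonsing_inv _ h.isUnit_det, Matrix.one_mulVec]⟩

variable (Γ)

theorem pair_comm (x y : V → ℤ) : Γ.pair x y = Γ.pair y x := by
  have e : ((Γ.M.map (Int.cast : ℤ → ℚ))⁻¹)ᵀ = (Γ.M.map (Int.cast : ℤ → ℚ))⁻¹ := by
    rw [Matrix.transpose_nonsing_inv, ← Matrix.transpose_map, M_transpose]
  rw [pair, pair, Matrix.dotProduct_mulVec, ← Matrix.mulVec_transpose, e, dotProduct_comm]

theorem pair_add_left (x y z : V → ℤ) : Γ.pair (x + y) z = Γ.pair x z + Γ.pair y z := by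
  rw [pair, pair, pair, ← add_dotProduct]
  congr 1
  funext v
  simp

theorem pair_add_right (x y z : V → ℤ) : Γ.pair x (y + z) = Γ.pair x y + Γ.pair x z := by
  rw [pair_comm, pair_add_left, pair_comm, Γ.pair_comm z]

theorem pair_smul_left (n : ℤ) (x y : V → ℤ) : Γ.pair (n • x) y = n * Γ.pair x y := by
  have : (fun v => ((n • x) v : ℚ)) = (n : ℚ) • fun v => (x v : ℚ) := by
    funext v
    simp
  rw [pair, pair, this, smul_dotProduct, smul_eq_mul]

theorem pair_smul_right (n : ℤ) (x y : V → ℤ) : Γ.pair x (n • y) = n * Γ.pair x y := by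
  rw [pair_comm, pair_smul_left, pair_comm]

variable {Γ}

theorem pair_mulVec (h : Γ.NegDef) (x y : V → ℤ) :
    Γ.pair x (Γ.M *ᵥ y) = ((x ⬝ᵥ y : ℤ) : ℚ) := by
  rw [pair_eq h (z := fun v => (y v : ℚ))]
  · simp [dotProduct]
  · funext v
    simp [Matrix.mulVec, dotProduct]

theorem hU_add_mulVec (h : Γ.NegDef) (K x : V → ℤ) :
    Γ.hU (K + 2 • (Γ.M *ᵥ x)) = Γ.hU K + ((K ⬝ᵥ x + x ⬝ᵥ (Γ.M *ᵥ x) : ℤ) : ℚ) := by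
  have e : K + 2 • (Γ.M *ᵥ x) = K + (2 : ℤ) • (Γ.M *ᵥ x) := by simp [two_smul]
  rw [e, hU, hU]
  simp only [pair_add_left, pair_add_right, pair_smul_left, pair_smul_right]
  rw [Γ.pair_comm (Γ.M *ᵥ x) K, pair_mulVec h, pair_mulVec h, dotProduct_comm (Γ.M *ᵥ x) x]
  push_cast
  ring

/-- The Cauchy–Schwarz bound for the coordinates of a vector. -/
theorem sq_le_pair (h : Γ.NegDef) (K : V → ℤ) (v : V) :
    (K v : ℚ) ^ 2 ≤ Γ.weight v * Γ.pair K K := by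
  obtain ⟨z, hz⟩ := exists_solution h K
  have hw : (Γ.weight v : ℚ) < 0 := by exact_mod_cast h.weight_neg v
  -- The critical point of `t ↦ q(z + t e_v)`, where q is the form of M; the bound is `q ≤ 0` there.
  set t : ℚ := -K v / Γ.weight v with ht
  have e := h.dotProduct_nonpos (z + t • Pi.single v 1)
  have hs : (Γ.M.map (Int.cast : ℤ → ℚ))ᵀ = Γ.M.map Int.cast := by
    rw [← Matrix.transpose_map, M_transpose]
  have h1 : z ⬝ᵥ (Γ.M.map (Int.cast : ℤ → ℚ) *ᵥ Pi.single v 1) = K v := by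
    rw [Matrix.dotProduct_mulVec, ← Matrix.mulVec_transpose, hs, hz]
    simp
  have h2 : (Pi.single v 1 : V → ℚ) ⬝ᵥ (Γ.M.map (Int.cast : ℤ → ℚ) *ᵥ Pi.single v 1) =
      Γ.weight v := by
    simp [M_self]
  have h3 : z ⬝ᵥ (Γ.M.map (Int.cast : ℤ → ℚ) *ᵥ z) = Γ.pair K K := by
    rw [pair_eq h hz, hz, dotProduct_comm]
  rw [Matrix.mulVec_add, Matrix.mulVec_smul, dotProduct_add, add_dotProduct, add_dotProduct,
    dotProduct_smul, dotProduct_smul, smul_dotProduct, smul_dotProduct, h1, h2, h3, hz,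
    single_one_dotProduct] at e
  simp only [smul_eq_mul] at e
  have h4 : t * Γ.weight v = -K v := by
    rw [ht, div_mul_cancel₀ _ hw.ne]
  rw [h4] at e
  have h5 : Γ.pair K K + t * K v ≤ 0 := by linarith
  have h6 := mul_le_mul_of_nonpos_left h5 hw.le
  linear_combination h6 + (K v : ℚ) * h4

/-- Makes all components finite, so that their weights are finite sums which can be split and
regrouped. -/
theorem finite_le_hU (h : Γ.NegDef) (i : ℚ) : {K : V → ℤ | i ≤ Γ.hU K}.Finite := by
  have key : ∀ v : V, {n : ℤ | (n : ℚ) ^ 2 ≤ Γ.weight v * (4 * i - Fintype.card V)}.Finite := by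
    intro v
    obtain ⟨N, hN⟩ := exists_nat_ge ((Γ.weight v : ℚ) * (4 * i - Fintype.card V))
    refine (Set.finite_Icc (-(N : ℤ)) N).subset fun n hn => ?_
    have h1 : (n : ℚ) ^ 2 ≤ N := le_trans hn hN
    have h2 : n ^ 2 ≤ (N : ℤ) := by exact_mod_cast h1
    -- For an integer, |n| ≤ n².
    exact ⟨by nlinarith, by nlinarith⟩
  refine (Set.Finite.pi fun v => key v).subset fun K hK v _ => ?_
  have hw : (Γ.weight v : ℚ) < 0 := by exact_mod_cast h.weight_neg v
  have h1 := sq_le_pair h K v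
  have h2 : 4 * i - Fintype.card V ≤ Γ.pair K K := by
    have : i ≤ (Γ.pair K K + Fintype.card V) / 4 := hK
    linarith
  refine h1.trans ?_
  nlinarith

end Form

/-! ### The orthogonal splitting of the form after a blow-up -/

namespace Move

variable {V : Type*} [DecidableEq V] {Γ : MarkedPlumbing V}

/-- The orthogonal projection from the characteristic vectors of the new graph to those of the
old one. -/
def proj (μ : Γ.Move) (K : Option V → ℤ) : V → ℤ := fun u => K (some u) + K none * μ.support u

/-- The vector with given projection and given coordinate at the new vertex. -/
def lift (μ : Γ.Move) (K : V → ℤ) (c : ℤ) : Option V → ℤ :=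
  fun x => x.elim c fun u => K u - c * μ.support u

@[simp] theorem lift_none (μ : Γ.Move) (K : V → ℤ) (c : ℤ) : μ.lift K c none = c := rfl

@[simp] theorem proj_lift (μ : Γ.Move) (K : V → ℤ) (c : ℤ) : μ.proj (μ.lift K c) = K := by
  funext u
  simp [proj, lift]

@[simp] theorem lift_proj (μ : Γ.Move) (K : Option V → ℤ) : μ.lift (μ.proj K) (K none) = K := by
  funext x
  cases x <;> simp [proj, lift]

theorem proj_add (μ : Γ.Move) (K L : Option V → ℤ) : μ.proj (K + L) = μ.proj K + μ.proj L := by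
  funext u
  simp only [proj, Pi.add_apply]
  ring

theorem proj_smul (μ : Γ.Move) (n : ℕ) (K : Option V → ℤ) : μ.proj (n • K) = n • μ.proj K := by
  funext u
  simp only [proj, Pi.smul_apply, nsmul_eq_mul]
  ring

theorem ext_proj (μ : Γ.Move) {K L : Option V → ℤ} (h : μ.proj K = μ.proj L)
    (h' : K none = L none) : K = L := by
  rw [← μ.lift_proj K, h, h', lift_proj]

variable [Fintype V]

section

variable {S : Type*} [CommRing S]

theorem result_mulVec_none (μ : Γ.Move) (x : Option V → S) :
    (μ.result.M.map (Int.cast : ℤ → S) *ᵥ x) none =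
      (∑ u, (μ.support u : S) * x (some u)) - x none := by
  simp only [Matrix.mulVec, dotProduct, Fintype.sum_option, Matrix.map_apply, M_none_none,
    M_none_some]
  push_cast
  ring

theorem result_mulVec_some (μ : Γ.Move) (x : Option V → S) (v : V) :
    (μ.result.M.map (Int.cast : ℤ → S) *ᵥ x) (some v) =
      (Γ.M.map (Int.cast : ℤ → S) *ᵥ fun u => x (some u)) v -
        μ.support v * ((∑ u, (μ.support u : S) * x (some u)) - x none) := by
  simp only [Matrix.mulVec, dotProduct, Fintype.sum_option, Matrix.map_apply, M_some_none,
    M_some_some]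
  push_cast
  simp only [sub_mul, Finset.sum_sub_distrib, mul_sub, Finset.mul_sum, mul_assoc]
  ring

/-- Completing the square at the new vertex, whose weight is -1: the lowered weights, and the edge
removed in (A), are exactly the correction -σσᵀ. -/
theorem result_form (μ : Γ.Move) (x : Option V → S) :
    x ⬝ᵥ (μ.result.M.map (Int.cast : ℤ → S) *ᵥ x) =
      (fun u => x (some u)) ⬝ᵥ (Γ.M.map (Int.cast : ℤ → S) *ᵥ fun u => x (some u)) -
        (x none - ∑ u, (μ.support u : S) * x (some u)) ^ 2 := by
  have e : ∀ t : S, ∑ u, x (some u) * (μ.support u * t) =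
      (∑ u, (μ.support u : S) * x (some u)) * t := by
    intro t
    rw [Finset.sum_mul]
    exact Finset.sum_congr rfl fun u _ => by ring
  rw [dotProduct, Fintype.sum_option]
  simp only [result_mulVec_none, result_mulVec_some, mul_sub (x (some _)), Finset.sum_sub_distrib, e]
  rw [dotProduct]
  ring

end

theorem mulVec_none (μ : Γ.Move) (x : Option V → ℤ) :
    (μ.result.M *ᵥ x) none = (∑ u, μ.support u * x (some u)) - x none := by
  have := μ.result_mulVec_none x
  rwa [map_intCast_self] at this

theorem mulVec_some (μ : Γ.Move) (x : Option V → ℤ) (v : V) :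
    (μ.result.M *ᵥ x) (some v) = (Γ.M *ᵥ fun u => x (some u)) v -
        μ.support v * ((∑ u, μ.support u * x (some u)) - x none) := by
  have := μ.result_mulVec_some x v
  rwa [map_intCast_self, map_intCast_self] at this

theorem proj_mulVec (μ : Γ.Move) (x : Option V → ℤ) :
    μ.proj (μ.result.M *ᵥ x) = Γ.M *ᵥ fun u => x (some u) := by
  funext v
  rw [proj, mulVec_none, mulVec_some]
  ring

theorem negDef_result_iff (μ : Γ.Move) : μ.result.NegDef ↔ Γ.NegDef := by
  rw [negDef_iff, negDef_iff]
  constructor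
  · intro h x hx
    -- The coordinate at the new vertex is chosen to make the square in `result_form` vanish.
    have := h (fun y => y.elim (∑ u, (μ.support u : ℝ) * x u) x) fun e => hx (by
      funext u
      exact congrFun e (some u))
    rw [result_form] at this
    simpa using this
  · intro h x hx
    rw [result_form]
    by_cases hx' : (fun u => x (some u)) = 0
    · have hx0 : x none ≠ 0 := fun e => hx (by
        funext y
        cases y with
        | none => exact e
        | some u => exact congrFun hx' u)
      have e : ∀ u, x (some u) = 0 := congrFun hx'
      simpa [e] using sq_pos_of_ne_zero hx0
    · have := h _ hx'
      nlinarith [sq_nonneg (x none - ∑ u, (μ.support u : ℝ) * x (some u))]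

/-- If z solves the old system for the projection of y, then z extended by σ·z - y₀ solves the new
system for y. -/
theorem pair_result (μ : Γ.Move) (h : Γ.NegDef) (x y : Option V → ℤ) :
    μ.result.pair x y = Γ.pair (μ.proj x) (μ.proj y) - x none * y none := by
  obtain ⟨z, hz⟩ := exists_solution h (μ.proj y)
  rw [pair_eq h hz, pair_eq (μ.negDef_result_iff.2 h)
    (z := fun v => v.elim ((∑ u, (μ.support u : ℚ) * z u) - y none) z)]
  · simp only [dotProduct, Fintype.sum_option, Option.elim, proj]
    push_cast
    simp only [add_mul, Finset.sum_add_distrib, mul_assoc, ← Finset.mul_sum]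
    ring
  · funext v
    cases v with
    | none => rw [result_mulVec_none]; simp
    | some v =>
      rw [result_mulVec_some]
      have := congrFun hz v
      simp only [Option.elim] at this ⊢
      rw [this, proj]
      push_cast
      ring

end Move

end MarkedPlumbing

/-! ### Degrees after a subdivision or an attachment of a leaf -/

section Degrees

variable {V : Type*}

theorem eq_new_or_old (y : Option (Option V)) : y = some none ∨ ∃ x, y = oldVertex V x := by
  match y with
  | none => exact .inr ⟨none, rfl⟩
  | some none => exact .inl rfl
  | some (some v) => exact .inr ⟨some v, rfl⟩

theorem neighborSet_new {G : SimpleGraph (Option (Option V))} {s : Set (Option V)}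
    (h : ∀ y, G.Adj (some none) (oldVertex V y) ↔ y ∈ s) :
    G.neighborSet (some none) = oldVertex V '' s := by
  ext y
  rcases eq_new_or_old y with rfl | ⟨y, rfl⟩
  · simp [oldVertex_ne_new]
  · simp [h]

theorem neighborSet_old {G : SimpleGraph (Option (Option V))} {x : Option V} {s : Set (Option V)}
    (h : ∀ y, G.Adj (oldVertex V x) (oldVertex V y) ↔ y ∈ s)
    (h' : ¬ G.Adj (some none) (oldVertex V x)) :
    G.neighborSet (oldVertex V x) = oldVertex V '' s := by
  ext y
  rcases eq_new_or_old y with rfl | ⟨y, rfl⟩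
  · simpa [oldVertex_ne_new] using fun e : G.Adj _ _ => h' e.symm
  · simp [h]

theorem neighborSet_old_of_adj_new {G : SimpleGraph (Option (Option V))} {x : Option V}
    {s : Set (Option V)} (h : ∀ y, G.Adj (oldVertex V x) (oldVertex V y) ↔ y ∈ s)
    (h' : G.Adj (some none) (oldVertex V x)) :
    G.neighborSet (oldVertex V x) = insert (some none) (oldVertex V '' s) := by
  ext y
  rcases eq_new_or_old y with rfl | ⟨y, rfl⟩
  · simpa using h'.symm
  · simp [h, oldVertex_ne_new]

theorem ncard_insert_new [Finite V] (s : Set (Option V)) :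
    (insert (some none) (oldVertex V '' s)).ncard = s.ncard + 1 := by
  rw [Set.ncard_insert_of_notMem (by simp [oldVertex_ne_new]) (Set.toFinite _),
    Set.ncard_image_of_injective _ (oldVertex V).injective]

theorem ncard_neighborSet_subdivide_new {G : SimpleGraph (Option V)} {a b : Option V}
    (hab : G.Adj a b) : ((subdivide G a b).neighborSet (some none)).ncard = 2 := by
  rw [neighborSet_new (s := {a, b}) (subdivide_adj_new G a b),
    Set.ncard_image_of_injective _ (oldVertex V).injective, Set.ncard_pair hab.ne]

/-- Each end of the subdivided edge trades its other end for the new vertex. -/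
theorem ncard_neighborSet_subdivide_old [Finite V] {G : SimpleGraph (Option V)} {a b : Option V}
    (hab : G.Adj a b) (x : Option V) :
    ((subdivide G a b).neighborSet (oldVertex V x)).ncard = (G.neighborSet x).ncard := by
  have key : ∀ c d : Option V, G.Adj c d →
      (G.neighborSet c \ {d}).ncard + 1 = (G.neighborSet c).ncard := fun c d h =>
    Set.ncard_sdiff_singleton_add_one h (Set.toFinite _)
  by_cases hxa : x = a
  · subst hxa
    rw [neighborSet_old_of_adj_new (s := G.neighborSet x \ {b}), ncard_insert_new,
      key _ _ hab]
    · intro y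
      rw [subdivide_adj_old]
      simp only [ne_eq, Sym2.congr_right, Set.mem_sdiff, SimpleGraph.mem_neighborSet,
        Set.mem_singleton_iff]
    · simp [subdivide_adj_new]
  by_cases hxb : x = b
  · subst hxb
    rw [neighborSet_old_of_adj_new (s := G.neighborSet x \ {a}), ncard_insert_new,
      key _ _ hab.symm]
    · intro y
      rw [subdivide_adj_old, Sym2.eq_swap (a := a)]
      simp only [ne_eq, Sym2.congr_right, Set.mem_sdiff, SimpleGraph.mem_neighborSet,
        Set.mem_singleton_iff]
    · simp [subdivide_adj_new]
  rw [neighborSet_old (s := G.neighborSet x), Set.ncard_image_of_injective _ (oldVertex V).injective]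
  · intro y
    simp [subdivide_adj_old, hxa, hxb]
  · simp [subdivide_adj_new, hxa, hxb]

theorem ncard_neighborSet_attachLeaf_new (G : SimpleGraph (Option V)) (a : Option V) :
    ((attachLeaf G a).neighborSet (some none)).ncard = 1 := by
  rw [neighborSet_new (s := {a}) (attachLeaf_adj_new G a),
    Set.ncard_image_of_injective _ (oldVertex V).injective, Set.ncard_singleton]

theorem ncard_neighborSet_attachLeaf_self [Finite V] (G : SimpleGraph (Option V)) (a : Option V) :
    ((attachLeaf G a).neighborSet (oldVertex V a)).ncard = (G.neighborSet a).ncard + 1 := by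
  rw [neighborSet_old_of_adj_new (s := G.neighborSet a) (attachLeaf_adj_old G a a)
    ((attachLeaf_adj_new G a a).2 rfl), ncard_insert_new]

theorem ncard_neighborSet_attachLeaf_of_ne (G : SimpleGraph (Option V)) {a x : Option V}
    (h : x ≠ a) :
    ((attachLeaf G a).neighborSet (oldVertex V x)).ncard = (G.neighborSet x).ncard := by
  rw [neighborSet_old (s := G.neighborSet x) (attachLeaf_adj_old G a x)
    (by simpa [attachLeaf_adj_new] using h),
    Set.ncard_image_of_injective _ (oldVertex V).injective]

end Degrees

/-! ### Uniform numerical data of the four moves -/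

namespace MarkedPlumbing

namespace Move

variable {V : Type*} {Γ : MarkedPlumbing V}

/-- `1` if the new vertex is adjacent to the marked vertex and `0` otherwise. -/
def link (μ : Γ.Move) : ℤ :=
  match μ with
  | .A _ _ _ => 0
  | .A0 _ _ => 1
  | .B _ => 0
  | .B0 => 1

theorem link_eq (μ : Γ.Move) : μ.link = 0 ∨ μ.link = 1 := by
  cases μ <;> simp [link]

/-- `1` if the new vertex subdivides an edge and `0` if it is a leaf. -/
def edgeType (μ : Γ.Move) : ℕ :=
  match μ with
  | .A _ _ _ => 1
  | .A0 _ _ => 1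
  | .B _ => 0
  | .B0 => 0

variable [DecidableEq V]

theorem support_eq (μ : Γ.Move) (u : V) : μ.support u = 0 ∨ μ.support u = 1 := by
  cases μ with
  | A v w h =>
    have hvw : v ≠ w := fun e => h.ne (by rw [e])
    simp only [support, Pi.add_apply, Pi.single_apply]
    by_cases h1 : u = v <;> by_cases h2 : u = w <;> simp_all
  | A0 v h => by_cases h1 : u = v <;> simp [support, h1]
  | B v => by_cases h1 : u = v <;> simp [support, h1]
  | B0 => simp [support]

/-- Only (A0) has such a vertex. This is what makes the changes of h_U and h_V differ when edges are
lifted for the bigraded root. -/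
theorem lam_eq_one (μ : Γ.Move) (h : μ.link = 1) {u : V} (hu : μ.support u = 1) :
    Γ.lam u = 1 := by
  cases μ with
  | A v w h' => simp [link] at h
  | A0 v h' =>
    by_cases h1 : u = v
    · subst h1
      simp [lam, h']
    · simp [support, h1] at hu
  | B v => simp [link] at h
  | B0 => simp [support] at hu

variable [Fintype V]

open Classical in
theorem lam_result_none (μ : Γ.Move) : μ.result.lam none = μ.link := by
  have e : μ.result.lam none =
      if μ.result.graph.Adj (some none) (oldVertex V none) then 1 else 0 := by
    by_cases h : μ.result.graph.Adj none (some none)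
    · simp [lam, oldVertex_none, h, h.symm]
    · have h' : ¬ μ.result.graph.Adj (some none) none := fun e => h e.symm
      simp [lam, oldVertex_none, h, h']
  rw [e]
  cases μ with
  | A v w h => simp [result, link, subdivide_adj_new]
  | A0 v h => simp [result, link, subdivide_adj_new]
  | B v => simp [result, link, attachLeaf_adj_new]
  | B0 => simp [result, link, attachLeaf_adj_new]

open Classical in
theorem lam_result_some (μ : Γ.Move) (u : V) :
    μ.result.lam (some u) = Γ.lam u - μ.link * μ.support u := by
  have e : μ.result.lam (some u) =
      if μ.result.graph.Adj (oldVertex V none) (oldVertex V (some u)) then 1 else 0 := by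
    by_cases h : μ.result.graph.Adj none (some (some u)) <;>
      simp [lam, oldVertex_some, oldVertex_none, h]
  rw [e]
  cases μ with
  | A v w h => simp [result, lam, link, subdivide_adj_old]
  | A0 v h =>
    simp only [result, lam, link, support, subdivide_adj_old, Pi.single_apply, ne_eq,
      Sym2.congr_right, Option.some_inj]
    by_cases hu : u = v <;> simp_all
  | B v => simp [result, lam, link, attachLeaf_adj_old]
  | B0 => simp [result, lam, link, support, attachLeaf_adj_old]

/-- So the new λ projects to the old one, and h_V transforms like h_U with c replaced by c + 2ℓ. -/
theorem lam_result (μ : Γ.Move) : μ.result.lam = μ.lift Γ.lam μ.link := by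
  funext x
  cases x with
  | none => exact μ.lam_result_none
  | some u => exact μ.lam_result_some u

theorem deg_result_new (μ : Γ.Move) : μ.result.deg (some none) = μ.edgeType + 1 := by
  cases μ with
  | A v w h => exact ncard_neighborSet_subdivide_new h
  | A0 v h => exact ncard_neighborSet_subdivide_new h
  | B v => exact ncard_neighborSet_attachLeaf_new _ _
  | B0 => exact ncard_neighborSet_attachLeaf_new _ _

theorem sum_support (μ : Γ.Move) : ∑ u, μ.support u = μ.edgeType + 1 - μ.link := by
  cases μ <;> simp [support, edgeType, link, Finset.sum_add_distrib]

theorem deg_result_of_edgeType (μ : Γ.Move) (h : μ.edgeType = 1) (x : Option V) :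
    μ.result.deg (oldVertex V x) = Γ.deg x := by
  cases μ with
  | A v w h' => exact ncard_neighborSet_subdivide_old h' x
  | A0 v h' => exact ncard_neighborSet_subdivide_old h' x
  | B v => simp [edgeType] at h
  | B0 => simp [edgeType] at h

theorem deg_result_B_self (v : V) :
    (Move.B v : Γ.Move).result.deg (some (some v)) = Γ.deg (some v) + 1 :=
  ncard_neighborSet_attachLeaf_self _ _

theorem deg_result_B_of_ne (v : V) {x : Option V} (h : x ≠ some v) :
    (Move.B v : Γ.Move).result.deg (oldVertex V x) = Γ.deg x :=
  ncard_neighborSet_attachLeaf_of_ne _ h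

theorem deg_result_B0_none : (Move.B0 : Γ.Move).result.deg none = Γ.deg none + 1 :=
  ncard_neighborSet_attachLeaf_self _ _

theorem deg_result_B0_some (u : V) :
    (Move.B0 : Γ.Move).result.deg (some (some u)) = Γ.deg (some u) :=
  ncard_neighborSet_attachLeaf_of_ne Γ.graph (a := none) (x := some u) (by simp)

end Move

end MarkedPlumbing

/-! ### Characteristic vectors and superlevel sets after a move -/

namespace MarkedPlumbing

open SimpleGraph

section Lattice

variable {V : Type*} {Γ : MarkedPlumbing V}

theorem two_nsmul_apply {A : Type*} (x : A → ℤ) (a : A) : (2 • x) a = 2 * x a := by simp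

theorem Char.exists_eq {K : V → ℤ} (hK : K ∈ Γ.Char) (v : V) :
    ∃ n, K v + Γ.weight v = 2 * n := by
  obtain ⟨x, rfl⟩ := hK
  refine ⟨Γ.weight v + x v, ?_⟩
  rw [Pi.add_apply, two_nsmul_apply]
  ring

theorem add_mem_Char {K : V → ℤ} (hK : K ∈ Γ.Char) (x : V → ℤ) : K + 2 • x ∈ Γ.Char := by
  obtain ⟨y, rfl⟩ := hK
  exact ⟨y + x, by rw [smul_add, add_assoc]⟩

variable [Fintype V]

/-- The class of a characteristic vector. -/
def Spinc.mk (K : Γ.Char) : Γ.Spinc := Quotient.mk Γ.spincSetoid K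

theorem Spinc.exists_mk (k : Γ.Spinc) : ∃ K, Spinc.mk K = k := Quotient.exists_rep k

theorem Spinc.mem_lattice_mk {K : V → ℤ} {K₀ : Γ.Char} :
    K ∈ (Spinc.mk K₀).lattice ↔
      ∃ x, K = K₀.1 + 2 • (Γ.M *ᵥ x) := by
  constructor
  · rintro ⟨hK, e⟩
    exact Quotient.exact e.symm
  · rintro ⟨x, rfl⟩
    exact ⟨add_mem_Char K₀.2 _, (Quotient.sound (s := Γ.spincSetoid) ⟨x, rfl⟩).symm⟩

end Lattice

namespace Move

variable {V : Type*} [DecidableEq V] {Γ : MarkedPlumbing V}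

theorem proj_betaVec (μ : Γ.Move) (K : V → ℤ) : μ.proj (μ.betaVec K) = K := by
  funext u
  cases μ <;> simp [proj, betaVec, support]

theorem betaVec_none (μ : Γ.Move) (K : V → ℤ) : ∃ n, μ.betaVec K none = 1 + 2 * n := by
  cases μ with
  | B0 => exact ⟨-1, by simp [betaVec]⟩
  | _ => exact ⟨0, by simp [betaVec]⟩

variable [Fintype V]

/-- Steps at the new vertex change c by any even number and leave the projection fixed, so only the
parity of c matters; the values 1 and -1 in `betaVec` are interchangeable here. -/
theorem mem_lattice_beta (μ : Γ.Move) (k : Γ.Spinc) (K : Option V → ℤ) :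
    K ∈ (μ.beta k).lattice ↔ μ.proj K ∈ k.lattice ∧ ∃ n, K none = 1 + 2 * n := by
  obtain ⟨K₀, rfl⟩ := Spinc.exists_mk k
  have e : μ.beta (Spinc.mk K₀) = Spinc.mk ⟨μ.betaVec K₀.1, μ.betaVec_mem K₀.2⟩ := rfl
  rw [e, Spinc.mem_lattice_mk, Spinc.mem_lattice_mk]
  dsimp only
  obtain ⟨m, hm⟩ := μ.betaVec_none K₀.1
  constructor
  · rintro ⟨x, rfl⟩
    refine ⟨⟨fun u => x (some u), ?_⟩, m + (μ.result.M *ᵥ x) none, ?_⟩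
    · rw [proj_add, proj_smul, proj_betaVec, proj_mulVec]
    · rw [Pi.add_apply, two_nsmul_apply, hm]
      ring
  · rintro ⟨⟨x, hx⟩, n, hn⟩
    -- Row `none` of the new matrix maps x to σ·x - x₀; this x₀ produces the prescribed last
    -- coordinate.
    refine ⟨fun y => y.elim ((∑ u, μ.support u * x u) - (n - m)) x, μ.ext_proj ?_ ?_⟩
    · rw [proj_add, proj_smul, proj_betaVec, proj_mulVec]
      exact hx
    · rw [Pi.add_apply, two_nsmul_apply, hm, hn, mulVec_none]
      simp only [Option.elim]
      ring

theorem proj_mem_Char (μ : Γ.Move) {K : Option V → ℤ} (hK : K ∈ μ.result.Char) :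
    μ.proj K ∈ Γ.Char := by
  obtain ⟨x, rfl⟩ := hK
  refine ⟨fun u => x (some u) + (x none - 1) * μ.support u, ?_⟩
  funext u
  simp only [proj, result, Pi.add_apply, two_nsmul_apply]
  ring

theorem beta_bijective (μ : Γ.Move) : Function.Bijective μ.beta := by
  constructor
  · intro k₁ k₂ e
    obtain ⟨K₁, rfl⟩ := Spinc.exists_mk k₁
    have h1 : μ.betaVec K₁.1 ∈ (μ.beta (Spinc.mk K₁)).lattice := by
      rw [mem_lattice_beta, proj_betaVec]
      exact ⟨⟨K₁.2, rfl⟩, μ.betaVec_none _⟩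
    rw [e, mem_lattice_beta, proj_betaVec] at h1
    exact h1.1.2
  · intro k'
    obtain ⟨K, rfl⟩ := Spinc.exists_mk k'
    refine ⟨Spinc.mk ⟨μ.proj K.1, μ.proj_mem_Char K.2⟩, ?_⟩
    obtain ⟨n, hn⟩ := Char.exists_eq K.2 none
    have hw : μ.result.weight none = -1 := rfl
    obtain ⟨_, h⟩ := (μ.mem_lattice_beta (Spinc.mk ⟨μ.proj K.1, μ.proj_mem_Char K.2⟩) K.1).2
      ⟨⟨_, rfl⟩, n, by omega⟩
    exact h.symm

theorem lift_mem_lattice_beta (μ : Γ.Move) (k : Γ.Spinc) (K : V → ℤ) (c : ℤ) :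
    μ.lift K c ∈ (μ.beta k).lattice ↔ K ∈ k.lattice ∧ ∃ n, c = 1 + 2 * n := by
  rw [mem_lattice_beta, proj_lift, lift_none]

theorem hU_result (μ : Γ.Move) (h : Γ.NegDef) (K : Option V → ℤ) :
    μ.result.hU K = Γ.hU (μ.proj K) + (1 - (K none : ℚ) ^ 2) / 4 := by
  rw [hU, hU, pair_result μ h, Fintype.card_option]
  push_cast
  ring

theorem hV_result (μ : Γ.Move) (h : Γ.NegDef) (K : Option V → ℤ) :
    μ.result.hV K = Γ.hV (μ.proj K) + (1 - (K none + 2 * μ.link : ℚ) ^ 2) / 4 := by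
  rw [hV, hV, hU_result μ h, proj_add, proj_smul, lam_result, proj_lift]
  simp

/-- The quotient is -n(n + 1), and a product of consecutive integers is even. -/
theorem one_sub_sq_div {c n : ℤ} (h : c = 1 + 2 * n) :
    ∃ m : ℤ, (1 - (c : ℚ) ^ 2) / 4 = 2 * m := by
  obtain ⟨m, hm⟩ := Int.even_mul_succ_self n
  refine ⟨-m, ?_⟩
  have : (n * (n + 1) : ℚ) = m + m := by exact_mod_cast hm
  subst h
  push_cast
  linear_combination -this

theorem gradesU_beta (μ : Γ.Move) (h : Γ.NegDef) (k : Γ.Spinc) :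
    (μ.beta k).gradesU = k.gradesU := by
  ext i
  constructor
  · rintro ⟨K, hK, n, rfl⟩
    obtain ⟨hK, m, hm⟩ := (μ.mem_lattice_beta k K).1 hK
    obtain ⟨r, hr⟩ := one_sub_sq_div hm
    refine ⟨_, hK, n + r, ?_⟩
    rw [hU_result μ h, hr]
    push_cast
    ring
  · rintro ⟨K, hK, n, rfl⟩
    refine ⟨μ.lift K 1, (μ.lift_mem_lattice_beta k K 1).2 ⟨hK, 0, by simp⟩, n, ?_⟩
    rw [hU_result μ h]
    simp

theorem gradesV_beta (μ : Γ.Move) (h : Γ.NegDef) (k : Γ.Spinc) :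
    (μ.beta k).gradesV = k.gradesV := by
  ext i
  have key : ∀ (c m : ℤ), c = 1 + 2 * m →
      ∃ r : ℤ, (1 - (c + 2 * μ.link : ℚ) ^ 2) / 4 = 2 * r := by
    intro c m hm
    obtain ⟨r, hr⟩ := one_sub_sq_div (c := c + 2 * μ.link) (n := m + μ.link) (by rw [hm]; ring)
    exact ⟨r, by exact_mod_cast hr⟩
  constructor
  · rintro ⟨K, hK, n, rfl⟩
    obtain ⟨hK, m, hm⟩ := (μ.mem_lattice_beta k K).1 hK
    obtain ⟨r, hr⟩ := key _ _ hm
    refine ⟨_, hK, n + r, ?_⟩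
    rw [hV_result μ h, hr]
    push_cast
    ring
  · rintro ⟨K, hK, n, rfl⟩
    obtain ⟨r, hr⟩ := key 1 0 (by simp)
    refine ⟨μ.lift K 1, (μ.lift_mem_lattice_beta k K 1).2 ⟨hK, 0, by simp⟩, n - r, ?_⟩
    rw [hV_result μ h, lift_none, hr]
    simp
    ring

theorem mem_superU_beta (μ : Γ.Move) (h : Γ.NegDef) (k : Γ.Spinc) (i : ℚ) (K : Option V → ℤ) :
    K ∈ (μ.beta k).superU i ↔ μ.proj K ∈ k.lattice ∧ (∃ n, K none = 1 + 2 * n) ∧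
      i ≤ Γ.hU (μ.proj K) + (1 - (K none : ℚ) ^ 2) / 4 := by
  rw [Spinc.superU, Set.mem_ofPred_eq, mem_lattice_beta, hU_result μ h, and_assoc]

theorem mem_superV_beta (μ : Γ.Move) (h : Γ.NegDef) (k : Γ.Spinc) (j : ℚ) (K : Option V → ℤ) :
    K ∈ (μ.beta k).superV j ↔ μ.proj K ∈ k.lattice ∧ (∃ n, K none = 1 + 2 * n) ∧
      j ≤ Γ.hV (μ.proj K) + (1 - (K none + 2 * μ.link : ℚ) ^ 2) / 4 := by
  rw [Spinc.superV, Set.mem_ofPred_eq, mem_lattice_beta, hV_result μ h, and_assoc]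

/-- Moving along the edges of the lattice graph at an old vertex. -/
theorem lift_add_some (μ : Γ.Move) (K : V → ℤ) (c : ℤ) (v : V) :
    μ.lift K c + 2 • (μ.result.M *ᵥ Pi.single (some v) 1) =
      μ.lift (K + 2 • (Γ.M *ᵥ Pi.single v 1)) (c + 2 * μ.support v) := by
  have e : (fun u => (Pi.single (some v) 1 : Option V → ℤ) (some u)) = Pi.single v 1 := by
    funext u
    simp [Pi.single_apply]
  refine μ.ext_proj ?_ ?_
  · rw [proj_add, proj_smul, proj_mulVec, proj_lift, proj_lift, e]
  · rw [Pi.add_apply, two_nsmul_apply, mulVec_none]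
    simp [Pi.single_apply]

/-- Moving along the edges of the lattice graph at the new vertex. -/
theorem lift_add_none (μ : Γ.Move) (K : V → ℤ) (c : ℤ) :
    μ.lift K c + 2 • (μ.result.M *ᵥ Pi.single none 1) = μ.lift K (c - 2) := by
  have e : (fun u => (Pi.single none 1 : Option V → ℤ) (some u)) = 0 := by
    funext u
    simp
  refine μ.ext_proj ?_ ?_
  · rw [proj_add, proj_smul, proj_mulVec, proj_lift, proj_lift, e]
    simp
  · rw [Pi.add_apply, two_nsmul_apply, mulVec_none]
    simp
    ring

end Move

theorem reachableIn_of_eq_add {V : Type*} [Fintype V] [DecidableEq V] {Γ : MarkedPlumbing V}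
    {S : Set (V → ℤ)} {K L : V → ℤ} (v : V) (hK : K ∈ S) (hL : L ∈ S)
    (h : K + 2 • (Γ.M *ᵥ Pi.single v 1) = L) : Γ.latticeGraph.ReachableIn S K L := by
  -- `SimpleGraph.fromRel` discards loops, so a zero step is treated apart.
  by_cases e : K = L
  · subst e
    exact .refl hK
  · exact .of_adj hK hL ((SimpleGraph.fromRel_adj _ _ _).2 ⟨e, .inl ⟨v, h.symm⟩⟩)

/-! ### Connected fibres and lifting of edges -/

namespace Move

variable {V : Type*} [DecidableEq V] {Γ : MarkedPlumbing V} [Fintype V]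

theorem reachableIn_fiber (μ : Γ.Move) {S : Set (Option V → ℤ)} (K : V → ℤ) (c : ℤ) (n : ℕ)
    (h : ∀ m : ℕ, m ≤ n → μ.lift K (c + 2 * m) ∈ S) :
    μ.result.latticeGraph.ReachableIn S (μ.lift K (c + 2 * n)) (μ.lift K c) := by
  induction n with
  | zero => simpa using ReachableIn.refl (h 0 le_rfl)
  | succ n ih =>
    refine .trans ?_ (ih fun m hm => h m (hm.trans n.le_succ))
    refine reachableIn_of_eq_add none (h _ le_rfl) (h n n.le_succ) ?_
    rw [lift_add_none]
    push_cast
    ring_nf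

/-- A set of characteristic vectors of the new graph whose fibres over the old lattice are
intervals has connected fibres. -/
theorem reachableIn_of_proj_eq (μ : Γ.Move) {S : Set (Option V → ℤ)}
    (hodd : ∀ K ∈ S, ∃ n, K none = 1 + 2 * n)
    (hconv : ∀ (K : V → ℤ) (a b c n : ℤ), μ.lift K a ∈ S → μ.lift K b ∈ S → a ≤ c → c ≤ b →
      c = 1 + 2 * n → μ.lift K c ∈ S)
    {K L : Option V → ℤ} (hK : K ∈ S) (hL : L ∈ S) (e : μ.proj K = μ.proj L) :
    μ.result.latticeGraph.ReachableIn S K L := by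
  wlog hle : L none ≤ K none generalizing K L
  · exact (this hL hK e.symm (le_of_not_ge hle)).symm
  obtain ⟨a, ha⟩ := hodd K hK
  obtain ⟨b, hb⟩ := hodd L hL
  obtain ⟨n, hn⟩ : ∃ n : ℕ, K none = L none + 2 * n := ⟨(a - b).toNat, by omega⟩
  have hK' : μ.lift (μ.proj L) (K none) = K := by rw [← e, lift_proj]
  have hL' := μ.lift_proj L
  have := μ.reachableIn_fiber (S := S) (μ.proj L) (L none) n fun m hm =>
    hconv _ (L none) (K none) _ (b + m) (by rwa [hL']) (by rwa [hK']) (by omega) (by omega)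
      (by omega)
  rwa [← hn, hK', hL'] at this

/-- Convexity of c²; hence the fibres of superlevel sets are intervals. -/
theorem le_of_between {i r : ℚ} {a b c : ℤ} (ha : i ≤ r + (1 - (a : ℚ) ^ 2) / 4)
    (hb : i ≤ r + (1 - (b : ℚ) ^ 2) / 4) (hac : a ≤ c) (hcb : c ≤ b) :
    i ≤ r + (1 - (c : ℚ) ^ 2) / 4 := by
  have h : c ^ 2 ≤ a ^ 2 ∨ c ^ 2 ≤ b ^ 2 := by
    rcases le_total 0 c with h | h
    · exact .inr (by nlinarith)
    · exact .inl (by nlinarith)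
  rcases h with h | h
  · have : (c : ℚ) ^ 2 ≤ a ^ 2 := by exact_mod_cast h
    linarith
  · have : (c : ℚ) ^ 2 ≤ b ^ 2 := by exact_mod_cast h
    linarith

theorem proj_adj (μ : Γ.Move) (K L : Option V → ℤ) (h : μ.result.latticeGraph.Adj K L) :
    μ.proj K = μ.proj L ∨ Γ.latticeGraph.Adj (μ.proj K) (μ.proj L) := by
  have key : ∀ (K : Option V → ℤ) x, μ.proj (K + 2 • (μ.result.M *ᵥ Pi.single x 1)) = μ.proj K ∨
      ∃ v, μ.proj (K + 2 • (μ.result.M *ᵥ Pi.single x 1)) =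
        μ.proj K + 2 • (Γ.M *ᵥ Pi.single v 1) := by
    intro K x
    rw [← μ.lift_proj K]
    cases x with
    | none => exact .inl (by rw [lift_add_none, proj_lift, proj_lift])
    | some v => exact .inr ⟨v, by rw [lift_add_some, proj_lift, proj_lift]⟩
  by_cases e : μ.proj K = μ.proj L
  · exact .inl e
  refine .inr ((SimpleGraph.fromRel_adj _ _ _).2 ⟨e, ?_⟩)
  obtain ⟨_, ⟨x, rfl⟩ | ⟨x, rfl⟩⟩ := (SimpleGraph.fromRel_adj _ _ _).1 h
  · exact .inl ((key K x).resolve_left (Ne.symm e))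
  · exact .inr ((key L x).resolve_left e)

theorem isComponentMap_superU (μ : Γ.Move) (h : Γ.NegDef) (k : Γ.Spinc) (i : ℚ) :
    IsComponentMap Γ.latticeGraph μ.result.latticeGraph μ.proj (k.superU i)
      ((μ.beta k).superU i) := by
  have hlift : ∀ K ∈ k.superU i, ∀ c : ℤ, c = 1 ∨ c = -1 →
      μ.lift K c ∈ (μ.beta k).superU i := by
    rintro K ⟨hK, hi⟩ c hc
    rw [mem_superU_beta μ h, proj_lift, lift_none]
    refine ⟨hK, ?_, ?_⟩
    · rcases hc with rfl | rfl
      · exact ⟨0, by simp⟩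
      · exact ⟨-1, by simp⟩
    · rcases hc with rfl | rfl <;> simpa using hi
  refine ⟨fun K hK => ?_, fun K hK => ⟨_, hlift K hK 1 (.inl rfl), μ.proj_lift _ _⟩, μ.proj_adj,
    fun K hK L hL e => μ.reachableIn_of_proj_eq ?_ ?_ hK hL e, ?_⟩
  · obtain ⟨hl, ⟨n, hn⟩, hi⟩ := (mem_superU_beta μ h k i K).1 hK
    refine ⟨hl, hi.trans ?_⟩
    have : 1 ≤ (K none) ^ 2 := by
      have : K none ≠ 0 := by omega
      exact Int.add_one_le_iff.2 (sq_pos_of_ne_zero this)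
    have : (1 : ℚ) ≤ (K none : ℚ) ^ 2 := by exact_mod_cast this
    linarith
  · exact fun K hK => ((mem_superU_beta μ h k i K).1 hK).2.1
  · intro K a b c n ha hb hac hcb hc
    rw [mem_superU_beta μ h, proj_lift, lift_none] at ha hb ⊢
    exact ⟨ha.1, ⟨n, hc⟩, le_of_between ha.2.2 hb.2.2 hac hcb⟩
  · have key : ∀ K ∈ k.superU i, ∀ v, K + 2 • (Γ.M *ᵥ Pi.single v 1) ∈ k.superU i →
        ∃ x y, μ.proj x = K ∧ μ.proj y = K + 2 • (Γ.M *ᵥ Pi.single v 1) ∧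
          μ.result.latticeGraph.ReachableIn ((μ.beta k).superU i) x y := by
      intro K hK v hL
      -- The edge at v raises c by 2σ_v, which is 0 or 2, so starting at -1 it ends at ±1, where the
      -- new h_U equals the old one.
      refine ⟨_, _, μ.proj_lift K (-1), μ.proj_lift _ (-1 + 2 * μ.support v),
        reachableIn_of_eq_add (some v) (hlift K hK _ (.inr rfl)) (hlift _ hL _ ?_)
          (μ.lift_add_some K (-1) v)⟩
      rcases μ.support_eq v with e | e <;> simp [e]
    intro K hK L hL hKL
    obtain ⟨_, ⟨v, rfl⟩ | ⟨v, rfl⟩⟩ := (SimpleGraph.fromRel_adj _ _ _).1 hKL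
    · exact key K hK v hL
    · obtain ⟨x, y, hx, hy, hr⟩ := key L hL v hK
      exact ⟨y, x, hy, hx, hr.symm⟩

theorem isComponentMap_superUV (μ : Γ.Move) (h : Γ.NegDef) (k : Γ.Spinc) (i j : ℚ) :
    IsComponentMap Γ.latticeGraph μ.result.latticeGraph μ.proj (k.superU i ∩ k.superV j)
      ((μ.beta k).superU i ∩ (μ.beta k).superV j) := by
  have hmem : ∀ (K : V → ℤ) (c : ℤ), μ.lift K c ∈ (μ.beta k).superU i ∩ (μ.beta k).superV j ↔
      K ∈ k.lattice ∧ (∃ n, c = 1 + 2 * n) ∧ i ≤ Γ.hU K + (1 - (c : ℚ) ^ 2) / 4 ∧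
        j ≤ Γ.hV K + (1 - ((c + 2 * μ.link : ℤ) : ℚ) ^ 2) / 4 := by
    intro K c
    rw [Set.mem_inter_iff, mem_superU_beta μ h, mem_superV_beta μ h, proj_lift, lift_none]
    push_cast
    tauto
  -- Both -1 and -1 + 2ℓ are ±1, so c = -1 costs nothing for either height; c = 1 would lower h_V by
  -- 2 when ℓ = 1.
  have hlift : ∀ K ∈ k.superU i ∩ k.superV j,
      μ.lift K (-1) ∈ (μ.beta k).superU i ∩ (μ.beta k).superV j := by
    rintro K ⟨⟨hK, hi⟩, _, hj⟩
    refine (hmem K (-1)).2 ⟨hK, ⟨-1, by simp⟩, by simpa using hi, ?_⟩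
    rcases μ.link_eq with e | e <;> simpa [e] using hj
  refine ⟨fun K hK => ?_, fun K hK => ⟨_, hlift K hK, μ.proj_lift _ _⟩, μ.proj_adj,
    fun K hK L hL e => μ.reachableIn_of_proj_eq ?_ ?_ hK hL e, ?_⟩
  · rw [← μ.lift_proj K, hmem] at hK
    obtain ⟨hl, ⟨n, hn⟩, hi, hj⟩ := hK
    have key : ∀ c m : ℤ, c = 1 + 2 * m → (1 : ℚ) ≤ (c : ℚ) ^ 2 := by
      intro c m hc
      have : c ≠ 0 := by omega
      exact_mod_cast Int.add_one_le_iff.2 (sq_pos_of_ne_zero this)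
    have h1 := key _ _ hn
    have h2 := key (K none + 2 * μ.link) (n + μ.link) (by rw [hn]; ring)
    exact ⟨⟨hl, by linarith⟩, hl, by linarith⟩
  · exact fun K hK => ((mem_superU_beta μ h k i K).1 hK.1).2.1
  · intro K a b c n ha hb hac hcb hc
    rw [hmem] at ha hb ⊢
    exact ⟨ha.1, ⟨n, hc⟩, le_of_between ha.2.2.1 hb.2.2.1 hac hcb,
      le_of_between ha.2.2.2 hb.2.2.2 (by linarith) (by linarith)⟩
  · have key : ∀ K ∈ k.superU i ∩ k.superV j, ∀ v,
        K + 2 • (Γ.M *ᵥ Pi.single v 1) ∈ k.superU i ∩ k.superV j →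
        ∃ x y, μ.proj x = K ∧ μ.proj y = K + 2 • (Γ.M *ᵥ Pi.single v 1) ∧
          μ.result.latticeGraph.ReachableIn ((μ.beta k).superU i ∩ (μ.beta k).superV j) x y := by
      intro K hK v hL
      suffices ∃ c : ℤ, μ.lift K c ∈ (μ.beta k).superU i ∩ (μ.beta k).superV j ∧
          μ.lift (K + 2 • (Γ.M *ᵥ Pi.single v 1)) (c + 2 * μ.support v) ∈
            (μ.beta k).superU i ∩ (μ.beta k).superV j by
        obtain ⟨c, h1, h2⟩ := this
        exact ⟨_, _, μ.proj_lift _ _, μ.proj_lift _ _,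
          reachableIn_of_eq_add (some v) h1 h2 (μ.lift_add_some K c v)⟩
      rcases μ.support_eq v with hs | hs
      · exact ⟨-1, hlift K hK, by simpa [hs] using hlift _ hL⟩
      rcases μ.link_eq with hl | hl
      · refine ⟨-1, hlift K hK, (hmem _ _).2 ⟨hL.1.1, ⟨0, by rw [hs]; norm_num⟩, ?_, ?_⟩⟩
        · simpa [hs] using hL.1.2
        · simpa [hs, hl] using hL.2.2
      -- Now σ_v = ℓ = 1. The lift with c from -1 to 1 loses 2 in h_V at the far end; the lift from
      -- -3 to -1 loses 2 in h_U at the near end. Along the edge h_U changes by 2n and h_V by 2n +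
      -- 2, so the sign of n decides which loss is affordable.
      have hlam := μ.lam_eq_one hl hs
      obtain ⟨n, hn⟩ := Char.exists_eq hK.1.1.1 v
      have hU' := hU_add_mulVec h K (Pi.single v 1)
      have hV' : Γ.hV (K + 2 • (Γ.M *ᵥ Pi.single v 1)) = _ :=
        (congrArg Γ.hU (add_right_comm _ _ _)).trans
          (hU_add_mulVec h (K + 2 • Γ.lam) (Pi.single v 1))
      have e1 : K ⬝ᵥ Pi.single v 1 + (Pi.single v 1 : V → ℤ) ⬝ᵥ (Γ.M *ᵥ Pi.single v 1) =
          2 * n := by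
        rw [← hn]
        simp [M_self]
      have e2 : (K + 2 • Γ.lam) ⬝ᵥ Pi.single v 1 +
          (Pi.single v 1 : V → ℤ) ⬝ᵥ (Γ.M *ᵥ Pi.single v 1) = 2 * n + 2 := by
        rw [add_dotProduct, add_right_comm, e1]
        simp [hlam]
      rw [e1] at hU'
      rw [e2] at hV'
      change _ = Γ.hV K + _ at hV'
      rcases lt_or_ge n 0 with hneg | hpos
      -- For n ≤ -1 the near end has h_U at least 2 above the far end, hence at least i + 2.
      · refine ⟨-3, (hmem _ _).2 ⟨hK.1.1, ⟨-2, by norm_num⟩, ?_, ?_⟩,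
          by simpa [hs] using hlift _ hL⟩
        · have hLi := hL.1.2
          have : (n : ℚ) ≤ -1 := by exact_mod_cast Int.le_sub_one_of_lt hneg
          rw [hU'] at hLi
          push_cast at hLi ⊢
          linarith
        · simpa [hl] using hK.2.2
      -- For n ≥ 0 the far end has h_V at least 2 above the near end, hence at least j + 2.
      · refine ⟨-1, hlift K hK, (hmem _ _).2 ⟨hL.1.1, ⟨0, by rw [hs]; norm_num⟩, ?_, ?_⟩⟩
        · simpa [hs] using hL.1.2
        · have hKj := hK.2.2
          have : (0 : ℚ) ≤ n := by exact_mod_cast hpos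
          rw [hV', hs, hl]
          push_cast
          linarith
    intro K hK L hL hKL
    obtain ⟨_, ⟨v, rfl⟩ | ⟨v, rfl⟩⟩ := (SimpleGraph.fromRel_adj _ _ _).1 hKL
    · exact key K hK v hL
    · obtain ⟨x, y, hx, hy, hr⟩ := key L hL v hK
      exact ⟨y, x, hy, hx, hr.symm⟩

end Move

end MarkedPlumbing

/-! ### Weights after a move -/

namespace Admissible

variable {R : Type*} [CommRing R] {W : ℕ → ℤ → R}

/-- The recursion at n = 2 forces all of `W 1` from the delta function `W 2`; it is supported at ±1,
as this and the next two lemmas record. -/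
theorem one_one (hW : Admissible W) : W 1 1 = -1 := by
  have := hW.step 2 (by norm_num) 1
  rw [hW.two_ne _ (by norm_num), sub_self, hW.two_zero] at this
  simpa using this.symm

theorem one_neg_one (hW : Admissible W) : W 1 (-1) = 1 := by
  have := hW.step 2 (by norm_num) (-1)
  rw [hW.two_ne (-1 - 1) (by norm_num), neg_add_cancel, hW.two_zero] at this
  simpa using this.symm

theorem one_ne (hW : Admissible W) {i : ℤ} (h1 : i ≠ 1) (h2 : i ≠ -1) : W 1 i = 0 := by
  have := hW.step 2 (by norm_num) i
  rw [hW.two_ne _ (by omega), hW.two_ne _ (by omega), sub_zero] at this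
  exact this.symm

theorem step_succ (hW : Admissible W) (n : ℕ) (i : ℤ) :
    W (n + 1) (i + 1) - W (n + 1) (i - 1) = W n i := by
  simpa using hW.step (n + 1) (by omega) i

/-- In coefficients: multiplying the expansion with index n + 1 by `t^{-1/2} z - t^{1/2} z⁻¹` gives
the one with index n. -/
theorem expansion_step (hW : Admissible W) (n : ℕ) (a b c : ℚ) :
    expansion W (n + 1) (a - 1) b (c + 1 / 2) - expansion W (n + 1) (a + 1) b (c - 1 / 2) =
      expansion W n a b c := by
  by_cases h : ∃ m : ℤ, a = m
  · obtain ⟨m, rfl⟩ := h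
    have e1 : (m : ℚ) - 1 = (m - 1 : ℤ) := by push_cast; ring
    have e2 : (m : ℚ) + 1 = (m + 1 : ℤ) := by push_cast; ring
    have h1 : c + 1 / 2 = -((m - 1 : ℤ) : ℚ) / 2 ↔ c = -(m : ℚ) / 2 := by
      push_cast
      constructor <;> intro h <;> linarith
    have h2 : c - 1 / 2 = -((m + 1 : ℤ) : ℚ) / 2 ↔ c = -(m : ℚ) / 2 := by
      push_cast
      constructor <;> intro h <;> linarith
    rw [e1, e2]
    simp only [expansion, h1, h2, Rat.den_intCast, Rat.num_intCast, true_and]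
    by_cases hbc : b = 0 ∧ c = -(m : ℚ) / 2
    · simp only [if_pos hbc]
      rw [← hW.step_succ n (-m)]
      ring_nf
    · simp only [if_neg hbc, sub_zero]
  -- If a is not an integer, neither are a ± 1, and all three coefficients vanish.
  · have key : ∀ x : ℚ, (∃ m : ℤ, a = x + m) → x.den ≠ 1 := by
      rintro x ⟨m, hm⟩ hx
      refine h ⟨x.num + m, ?_⟩
      rw [hm, ← Rat.den_eq_one_iff x |>.1 hx]
      simp
    have h0 := key a ⟨0, by simp⟩
    have h1 := key (a - 1) ⟨1, by simp⟩
    have h2 := key (a + 1) ⟨-1, by simp⟩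
    simp only [expansion, h0, h1, h2, false_and, if_false, sub_zero]

end Admissible

/-! ### Exponents, and sums over the fibres -/

namespace MarkedPlumbing

namespace Move

variable {V : Type*} [DecidableEq V] {Γ : MarkedPlumbing V}

theorem lift_injective (μ : Γ.Move) (c : ℤ) : Function.Injective fun K => μ.lift K c :=
  Function.LeftInverse.injective (g := μ.proj) fun K => μ.proj_lift K c

variable [Fintype V]

theorem deg_result_none (μ : Γ.Move) :
    (μ.result.deg none : ℤ) = Γ.deg none + (1 - μ.edgeType) * μ.link := by
  cases μ with
  | B0 =>
    rw [deg_result_B0_none]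
    simp [link, edgeType]
  | B v =>
    have : (Move.B v : Γ.Move).result.deg none = Γ.deg none :=
      deg_result_B_of_ne v (x := none) (by simp)
    simp [this, link]
  | A v w h =>
    have : (Move.A v w h : Γ.Move).result.deg none = Γ.deg none := deg_result_of_edgeType _ rfl none
    simp [this, link]
  | A0 v h =>
    have : (Move.A0 v h : Γ.Move).result.deg none = Γ.deg none := deg_result_of_edgeType _ rfl none
    simp [this, edgeType]

theorem sum_deg_result (μ : Γ.Move) :
    ∑ x, (μ.result.deg (some x) : ℤ) =
      ∑ u, (Γ.deg (some u) : ℤ) + 2 - (1 - μ.edgeType) * μ.link := by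
  rw [Fintype.sum_option, deg_result_new]
  cases μ with
  | B0 =>
    simp only [deg_result_B0_some, link, edgeType]
    push_cast
    ring
  | B v =>
    have : ∀ u, ((Move.B v : Γ.Move).result.deg (some (some u)) : ℤ) =
        Γ.deg (some u) + (Pi.single v 1 : V → ℤ) u := by
      intro u
      by_cases hu : u = v
      · subst hu
        simp [deg_result_B_self]
      · have : (Move.B v : Γ.Move).result.deg (some (some u)) = Γ.deg (some u) :=
          deg_result_B_of_ne v (x := some u) (by simpa using hu)
        simp [this, hu]
    simp [this, Finset.sum_add_distrib, link, edgeType]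
    ring
  | A v w h =>
    have : ∀ u, (Move.A v w h : Γ.Move).result.deg (some (some u)) = Γ.deg (some u) :=
      fun u => deg_result_of_edgeType _ rfl (some u)
    simp [this, link, edgeType]
    ring
  | A0 v h =>
    have : ∀ u, (Move.A0 v h : Γ.Move).result.deg (some (some u)) = Γ.deg (some u) :=
      fun u => deg_result_of_edgeType _ rfl (some u)
    simp [this, link, edgeType]
    ring

theorem sum_weight_result (μ : Γ.Move) :
    ∑ x, μ.result.weight x = ∑ v, Γ.weight v - (μ.edgeType + 1 - μ.link) - 1 := by
  rw [← sum_support, Fintype.sum_option]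
  simp only [result, Finset.sum_sub_distrib]
  ring

theorem sum_lift (μ : Γ.Move) (K : V → ℤ) (c : ℤ) :
    ∑ x, μ.lift K c x = ∑ v, K v + c * (μ.link - μ.edgeType) := by
  rw [Fintype.sum_option]
  simp only [lift, Option.elim, Finset.sum_sub_distrib, ← Finset.mul_sum, sum_support]
  ring

/-- The shifts of all three exponents depend only on c, ε, e and ℓ. They vanish for subdivisions at
c = ε and for (B) at c = ±1; for (B0) at c = ±1 they amount to `z^{-c} t^{c/2}`. -/
theorem zeta_result (μ : Γ.Move) (h : Γ.NegDef) (ε : ℤ) (K : V → ℤ) (c : ℤ) :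
    μ.result.zeta ε (μ.lift K c) = Γ.zeta ε K - μ.link * (c - ε * μ.edgeType) := by
  have hd : (μ.result.deg none : ℚ) = Γ.deg none + (1 - μ.edgeType) * μ.link := by
    exact_mod_cast μ.deg_result_none
  have hl : (μ.link : ℚ) * μ.link = μ.link := by rcases μ.link_eq with e | e <;> simp [e]
  rw [zeta, zeta, pair_result μ h, pair_result μ h, lam_result, proj_lift, proj_lift, lift_none,
    lift_none, hd]
  linear_combination (ε : ℚ) * hl

theorem theta_result (μ : Γ.Move) (ε : ℤ) (K : V → ℤ) (c : ℤ) :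
    μ.result.theta ε (μ.lift K c) =
      Γ.theta ε K + (c * (μ.link - μ.edgeType) + ε * μ.edgeType * (1 - μ.link)) / 2 := by
  have h1 : ∑ x, (μ.lift K c x : ℚ) = ∑ v, (K v : ℚ) + c * (μ.link - μ.edgeType) := by
    exact_mod_cast μ.sum_lift K c
  have h2 : ∑ x, (μ.result.deg (some x) : ℚ) =
      ∑ u, (Γ.deg (some u) : ℚ) + 2 - (1 - μ.edgeType) * μ.link := by
    exact_mod_cast μ.sum_deg_result
  have h3 : ∑ x, (μ.result.weight x : ℚ) =
      ∑ v, (Γ.weight v : ℚ) - (μ.edgeType + 1 - μ.link) - 1 := by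
    exact_mod_cast μ.sum_weight_result
  rw [theta, theta, Finset.sum_add_distrib, Finset.sum_add_distrib, h1, h2, h3]
  ring

theorem xi_result (μ : Γ.Move) (h : Γ.NegDef) (ε : ℤ) (K : V → ℤ) (c : ℤ) :
    μ.result.xi ε (μ.lift K c) =
      Γ.xi ε K + ((c : ℚ) ^ 2 - 1) / 4 + μ.edgeType * (1 - ε * c) / 2 := by
  have h1 : ∑ x, (μ.lift K c x : ℚ) = ∑ v, (K v : ℚ) + c * (μ.link - μ.edgeType) := by
    exact_mod_cast μ.sum_lift K c
  have h2 : ∑ x, (μ.result.deg (some x) : ℚ) =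
      ∑ u, (Γ.deg (some u) : ℚ) + 2 - (1 - μ.edgeType) * μ.link := by
    exact_mod_cast μ.sum_deg_result
  have h3 : ∑ x, (μ.result.weight x : ℚ) =
      ∑ v, (Γ.weight v : ℚ) - (μ.edgeType + 1 - μ.link) - 1 := by
    exact_mod_cast μ.sum_weight_result
  have hd : (μ.result.deg none : ℚ) = Γ.deg none + (1 - μ.edgeType) * μ.link := by
    exact_mod_cast μ.deg_result_none
  have hl : (μ.link : ℚ) * μ.link = μ.link := by rcases μ.link_eq with e | e <;> simp [e]
  rw [xi, xi, Fintype.sum_option, Fintype.sum_option (f := fun x => (Γ.deg x : ℚ)), h1, h2, h3, hd,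
    pair_result μ h, pair_result μ h, pair_result μ h, lam_result, proj_lift, proj_lift, lift_none,
    lift_none, Fintype.card_option]
  push_cast
  linear_combination (1 / 2 : ℚ) * hl

variable {R : Type*} [CommRing R] {W : ℕ → ℤ → R}

/-- The same number c - εe is the argument at the new vertex and the shift of the arguments at its
neighbours. -/
theorem pointWeight_result (μ : Γ.Move) (ε : ℤ) (K : V → ℤ) (c : ℤ) :
    μ.result.pointWeight ε W (μ.lift K c) = W (μ.edgeType + 1) (c - ε * μ.edgeType) *
      ∏ u, W (μ.result.deg (some (some u)))
        ((K - ε • (Γ.M *ᵥ (fun _ => 1) + Γ.lam)) u - μ.support u * (c - ε * μ.edgeType)) := by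
  rw [pointWeight, Fintype.prod_option, deg_result_new]
  refine congrArg₂ _ (congrArg _ ?_) (Finset.prod_congr rfl fun u _ => congrArg _ ?_)
  · simp only [Pi.sub_apply, Pi.smul_apply, Pi.add_apply, smul_eq_mul, lift_none, mulVec_none,
      lam_result_none, mul_one, sum_support]
    ring
  · simp only [Pi.sub_apply, Pi.smul_apply, Pi.add_apply, smul_eq_mul, lift, Option.elim,
      mulVec_some, lam_result_some, mul_one, sum_support]
    ring

/-- The contribution of a lattice point to the weight of a component. -/
noncomputable def _root_.MarkedPlumbing.term {V : Type*} [Fintype V] [DecidableEq V]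
    (Γ : MarkedPlumbing V) (ε : ℤ) (W : ℕ → ℤ → R) (a b c : ℚ) (K : V → ℤ) : R :=
  Γ.pointWeight ε W K *
    expansion W (Γ.deg none + 1) (a - Γ.zeta ε K) (b - Γ.xi ε K) (c - Γ.theta ε K)

theorem term_lift_eq_zero (μ : Γ.Move) (hW : Admissible W) {ε : ℤ} (hε : ε = 1 ∨ ε = -1)
    (a b c : ℚ) (K : V → ℤ) {n : ℤ} (h1 : n ≠ 1) (h2 : n ≠ -1) :
    μ.result.term ε W a b c (μ.lift K n) = 0 := by
  have : W (μ.edgeType + 1) (n - ε * μ.edgeType) = 0 := by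
    have h : μ.edgeType = 0 ∨ μ.edgeType = 1 := by cases μ <;> simp [edgeType]
    rcases h with h | h <;> rw [h]
    · simpa using hW.one_ne h1 h2
    · exact hW.two_ne _ (by push_cast; omega)
  rw [term, pointWeight_result, this, zero_mul, zero_mul]

/-- The factor `W 2 (c - ε)` selects c = ε, where no exponent or argument is shifted. -/
theorem term_lift_add_of_edgeType (μ : Γ.Move) (hneg : Γ.NegDef) (hW : Admissible W) {ε : ℤ}
    (hε : ε = 1 ∨ ε = -1) (hμ : μ.edgeType = 1) (a b c : ℚ) (K : V → ℤ) :
    μ.result.term ε W a b c (μ.lift K 1) + μ.result.term ε W a b c (μ.lift K (-1)) =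
      Γ.term ε W a b c K := by
  have hd : ∀ u, μ.result.deg (some (some u)) = Γ.deg (some u) :=
    fun u => μ.deg_result_of_edgeType hμ (some u)
  have hd0 : μ.result.deg none = Γ.deg none := μ.deg_result_of_edgeType hμ none
  have hε2 : (ε : ℚ) * ε = 1 := by rcases hε with rfl | rfl <;> norm_num
  have key : μ.result.term ε W a b c (μ.lift K ε) = Γ.term ε W a b c K := by
    have e0 : ε - ε * (1 : ℕ) = 0 := by simp
    have e1 : μ.result.zeta ε (μ.lift K ε) = Γ.zeta ε K := by
      rw [zeta_result μ hneg, hμ]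
      simp
    have e2 : μ.result.theta ε (μ.lift K ε) = Γ.theta ε K := by
      rw [theta_result, hμ]
      push_cast
      ring
    have e3 : μ.result.xi ε (μ.lift K ε) = Γ.xi ε K := by
      rw [xi_result μ hneg, hμ]
      push_cast
      linear_combination (-1 / 4 : ℚ) * hε2
    rw [term, term, e1, e2, e3, hd0, pointWeight_result, hμ, e0, hW.two_zero, one_mul]
    simp only [hd, mul_zero, sub_zero]
    rfl
  have key0 : μ.result.term ε W a b c (μ.lift K (-ε)) = 0 := by
    rw [term, pointWeight_result, hμ, hW.two_ne _ (by rcases hε with rfl | rfl <;> norm_num),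
      zero_mul, zero_mul]
  rcases hε with rfl | rfl
  · rw [key, key0, add_zero]
  · rw [neg_neg] at key0
    rw [key, key0, zero_add]

/-- The lifts c = ±1 carry the signs ∓1 and shift the argument at `v` by ∓1, while its degree grows
by one: their sum is the recursion for `W` at `v`. -/
theorem term_lift_add_B (v : V) (hneg : Γ.NegDef) (hW : Admissible W) {ε : ℤ} (a b c : ℚ)
    (K : V → ℤ) :
    (Move.B v : Γ.Move).result.term ε W a b c ((Move.B v : Γ.Move).lift K 1) +
      (Move.B v : Γ.Move).result.term ε W a b c ((Move.B v : Γ.Move).lift K (-1)) =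
      Γ.term ε W a b c K := by
  have hd0 : (Move.B v : Γ.Move).result.deg none = Γ.deg none :=
    deg_result_B_of_ne v (x := none) (by simp)
  have hξ : ∀ n : ℤ, n ^ 2 = 1 →
      (Move.B v : Γ.Move).result.xi ε ((Move.B v : Γ.Move).lift K n) = Γ.xi ε K := by
    intro n hn
    have : (n : ℚ) ^ 2 = 1 := by exact_mod_cast hn
    rw [xi_result _ hneg, this]
    simp [edgeType]
  have hp : ∀ n : ℤ, ∏ u, W ((Move.B v : Γ.Move).result.deg (some (some u)))
        ((K - ε • (Γ.M *ᵥ (fun _ => 1) + Γ.lam)) u - (Move.B v : Γ.Move).support u * n) =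
      W (Γ.deg (some v) + 1) ((K - ε • (Γ.M *ᵥ (fun _ => 1) + Γ.lam)) v - n) *
        ∏ u ∈ Finset.univ.erase v,
          W (Γ.deg (some u)) ((K - ε • (Γ.M *ᵥ (fun _ => 1) + Γ.lam)) u) := by
    intro n
    rw [← Finset.mul_prod_erase _ _ (Finset.mem_univ v), deg_result_B_self]
    congr 1
    · simp [support]
    · refine Finset.prod_congr rfl fun u hu => ?_
      have hu' : u ≠ v := Finset.ne_of_mem_erase hu
      have : (Move.B v : Γ.Move).result.deg (some (some u)) = Γ.deg (some u) :=
        deg_result_B_of_ne v (x := some u) (by simpa using hu')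
      rw [this]
      simp [support, hu']
  have hp0 : Γ.pointWeight ε W K =
      W (Γ.deg (some v)) ((K - ε • (Γ.M *ᵥ (fun _ => 1) + Γ.lam)) v) *
        ∏ u ∈ Finset.univ.erase v,
          W (Γ.deg (some u)) ((K - ε • (Γ.M *ᵥ (fun _ => 1) + Γ.lam)) u) :=
    (Finset.mul_prod_erase _ _ (Finset.mem_univ v)).symm
  have hζ : ∀ n : ℤ, (Move.B v : Γ.Move).result.zeta ε ((Move.B v : Γ.Move).lift K n) =
      Γ.zeta ε K := by
    intro n
    rw [zeta_result _ hneg]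
    simp [link]
  have hθ : ∀ n : ℤ, (Move.B v : Γ.Move).result.theta ε ((Move.B v : Γ.Move).lift K n) =
      Γ.theta ε K := by
    intro n
    rw [theta_result]
    simp [link, edgeType]
  rw [term, term, term, hζ, hζ, hθ, hθ, hξ 1 rfl, hξ (-1) rfl, hd0, pointWeight_result,
    pointWeight_result, hp, hp, hp0, ← hW.step_succ (Γ.deg (some v))]
  simp only [edgeType, Nat.cast_zero, mul_zero, sub_zero, zero_add, hW.one_one, hW.one_neg_one]
  rw [sub_neg_eq_add]
  ring

/-- Here the leaf raises the degree of the marked vertex, so the recursion acts on the prefactor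
(`expansion_step`) instead of on a vertex factor. -/
theorem term_lift_add_B0 (hneg : Γ.NegDef) (hW : Admissible W) {ε : ℤ} (a b c : ℚ)
    (K : V → ℤ) :
    (Move.B0 : Γ.Move).result.term ε W a b c ((Move.B0 : Γ.Move).lift K 1) +
      (Move.B0 : Γ.Move).result.term ε W a b c ((Move.B0 : Γ.Move).lift K (-1)) =
      Γ.term ε W a b c K := by
  have hξ : ∀ n : ℤ, n ^ 2 = 1 →
      (Move.B0 : Γ.Move).result.xi ε ((Move.B0 : Γ.Move).lift K n) = Γ.xi ε K := by
    intro n hn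
    have : (n : ℚ) ^ 2 = 1 := by exact_mod_cast hn
    rw [xi_result _ hneg, this]
    simp [edgeType]
  have hp : ∀ n : ℤ, (Move.B0 : Γ.Move).result.pointWeight ε W ((Move.B0 : Γ.Move).lift K n) =
      W 1 n * Γ.pointWeight ε W K := by
    intro n
    rw [pointWeight_result]
    simp only [deg_result_B0_some, support, edgeType, Nat.cast_zero, mul_zero, sub_zero, zero_add,
      Pi.zero_apply, zero_mul]
    rfl
  have hζ : ∀ n : ℤ, (Move.B0 : Γ.Move).result.zeta ε ((Move.B0 : Γ.Move).lift K n) =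
      Γ.zeta ε K - n := by
    intro n
    rw [zeta_result _ hneg]
    simp [link, edgeType]
  have hθ : ∀ n : ℤ, (Move.B0 : Γ.Move).result.theta ε ((Move.B0 : Γ.Move).lift K n) =
      Γ.theta ε K + n / 2 := by
    intro n
    rw [theta_result]
    simp [link, edgeType]
  rw [term, term, term, hζ, hζ, hθ, hθ, hξ 1 rfl, hξ (-1) rfl, deg_result_B0_none, hp, hp,
    hW.one_one, hW.one_neg_one, ← hW.expansion_step (Γ.deg none + 1)]
  have e1 : a - (Γ.zeta ε K - (1 : ℤ)) = a - Γ.zeta ε K + 1 := by push_cast; ring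
  have e2 : a - (Γ.zeta ε K - (-1 : ℤ)) = a - Γ.zeta ε K - 1 := by push_cast; ring
  have e3 : c - (Γ.theta ε K + (1 : ℤ) / 2) = c - Γ.theta ε K - 1 / 2 := by push_cast; ring
  have e4 : c - (Γ.theta ε K + (-1 : ℤ) / 2) = c - Γ.theta ε K + 1 / 2 := by push_cast; ring
  rw [e1, e2, e3, e4]
  ring

/-- Summing the contributions over a fibre of the projection. -/
theorem term_lift_add (μ : Γ.Move) (hneg : Γ.NegDef) (hW : Admissible W) {ε : ℤ}
    (hε : ε = 1 ∨ ε = -1) (a b c : ℚ) (K : V → ℤ) :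
    μ.result.term ε W a b c (μ.lift K 1) + μ.result.term ε W a b c (μ.lift K (-1)) =
      Γ.term ε W a b c K := by
  cases μ with
  | A v w h => exact term_lift_add_of_edgeType (.A v w h) hneg hW hε rfl a b c K
  | A0 v h => exact term_lift_add_of_edgeType (.A0 v h) hneg hW hε rfl a b c K
  | B v => exact term_lift_add_B v hneg hW a b c K
  | B0 => exact term_lift_add_B0 hneg hW a b c K

theorem componentWeight_result (μ : Γ.Move) (hneg : Γ.NegDef) (hW : Admissible W) {ε : ℤ}
    (hε : ε = 1 ∨ ε = -1) (k : Γ.Spinc) (i : ℚ) {C : Set (V → ℤ)} (hC : C ⊆ k.superU i) :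
    μ.result.componentWeight ε W (μ.proj ⁻¹' C ∩ (μ.beta k).superU i) =
      Γ.componentWeight ε W C := by
  have hfin : C.Finite := (finite_le_hU hneg i).subset fun K hK => (hC hK).2
  funext a b c
  change ∑ᶠ K ∈ μ.proj ⁻¹' C ∩ (μ.beta k).superU i, μ.result.term ε W a b c K =
    ∑ᶠ K ∈ C, Γ.term ε W a b c K
  have e : ∑ᶠ K ∈ μ.proj ⁻¹' C ∩ (μ.beta k).superU i, μ.result.term ε W a b c K =
      ∑ᶠ K ∈ (fun K => μ.lift K 1) '' C ∪ (fun K => μ.lift K (-1)) '' C,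
        μ.result.term ε W a b c K := by
    -- The two index sets differ in general, but only at points with c ≠ ±1, whose terms vanish.
    refine finsum_mem_inter_support_eq' _ _ _ fun K hK => ?_
    have hc : K none = 1 ∨ K none = -1 := by
      by_contra! hc
      rw [← μ.lift_proj K] at hK
      exact hK (μ.term_lift_eq_zero hW hε a b c _ hc.1 hc.2)
    constructor
    · rintro ⟨hKC, _⟩
      rcases hc with hc | hc
      · exact .inl ⟨_, hKC, by dsimp only; rw [← hc, lift_proj]⟩
      · exact .inr ⟨_, hKC, by dsimp only; rw [← hc, lift_proj]⟩
    · intro hK'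
      have hp : μ.proj K ∈ C := by
        rcases hK' with ⟨L, hL, rfl⟩ | ⟨L, hL, rfl⟩ <;> simpa using hL
      refine ⟨hp, (mem_superU_beta μ hneg k i K).2 ⟨(hC hp).1, ?_, ?_⟩⟩
      · rcases hc with hc | hc
        · exact ⟨0, by simp [hc]⟩
        · exact ⟨-1, by simp [hc]⟩
      · rcases hc with hc | hc <;> simpa [hc] using (hC hp).2
  have hdisj : Disjoint ((fun K => μ.lift K 1) '' C) ((fun K => μ.lift K (-1)) '' C) := by
    rw [Set.disjoint_left]
    rintro _ ⟨K, _, rfl⟩ ⟨L, _, h⟩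
    have := congrFun h none
    simp at this
  rw [e, finsum_mem_union hdisj (hfin.image _) (hfin.image _),
    finsum_mem_image (μ.lift_injective 1).injOn, finsum_mem_image (μ.lift_injective (-1)).injOn,
    ← finsum_mem_add_distrib hfin]
  exact finsum_mem_congr rfl fun K _ => μ.term_lift_add hneg hW hε a b c K

end Move

end MarkedPlumbing

/-! ### Isomorphisms of weighted roots -/

/-- Two weighted graded graphs are isomorphic if there is a bijection between their nodes that
respects gradings, weights and the relations that generate the edges. -/
theorem WeightedGradedGraph.isomorphic_of_equiv {D X : Type*} {R R' : WeightedGradedGraph D X}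
    (f : R.Node ≃ R'.Node) {r : R.Node → R.Node → Prop} {r' : R'.Node → R'.Node → Prop}
    (hR : R.graph = SimpleGraph.fromRel r) (hR' : R'.graph = SimpleGraph.fromRel r')
    (hr : ∀ n m, r' (f n) (f m) ↔ r n m) (hgrade : ∀ n, R'.grade (f n) = R.grade n)
    (hweight : ∀ n, R'.weight (f n) = R.weight n) : R.Isomorphic R' := by
  refine ⟨⟨f, fun {n m} => ?_⟩, hgrade, hweight⟩
  rw [hR, hR', SimpleGraph.fromRel_adj, SimpleGraph.fromRel_adj, hr, hr, f.injective.ne_iff]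

namespace MarkedPlumbing

open SimpleGraph

/-- Surjectivity recovers each component from its preimage, so inclusions between different levels,
which define the edges, are reflected as well as preserved. -/
theorem IsComponent.preimage_subset_iff {V V' : Type*} [Fintype V] [DecidableEq V] [Fintype V']
    [DecidableEq V'] {Γ : MarkedPlumbing V} {Γ' : MarkedPlumbing V'}
    {f : (V' → ℤ) → V → ℤ} {S T C D : Set (V → ℤ)} {S' T' : Set (V' → ℤ)}
    (hS : IsComponentMap Γ.latticeGraph Γ'.latticeGraph f S S')
    (hT : IsComponentMap Γ.latticeGraph Γ'.latticeGraph f T T') (hST : S' ⊆ T')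
    (hC : Γ.IsComponent S C) (hD : Γ.IsComponent T D) :
    f ⁻¹' C ∩ S' ⊆ f ⁻¹' D ∩ T' ↔ C ⊆ D := by
  constructor
  · intro h
    rw [← hC.image_preimage hS, ← hD.image_preimage hT]
    exact Set.image_mono h
  · exact fun h => Set.inter_subset_inter (Set.preimage_mono h) hST

section Antitone

variable {V : Type*} [Fintype V] [DecidableEq V] {Γ : MarkedPlumbing V} (k : Γ.Spinc)

theorem Spinc.superU_antitone {i i' : ℚ} (h : i' ≤ i) : k.superU i ⊆ k.superU i' :=
  fun _ hK => ⟨hK.1, h.trans hK.2⟩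

theorem Spinc.superV_antitone {j j' : ℚ} (h : j' ≤ j) : k.superV j ⊆ k.superV j' :=
  fun _ hK => ⟨hK.1, h.trans hK.2⟩

end Antitone

namespace Move

variable {V : Type*} [Fintype V] [DecidableEq V] {Γ : MarkedPlumbing V}
  {R : Type*} [CommRing R] {W : ℕ → ℤ → R}

theorem weightedRoot_isomorphic (μ : Γ.Move) (hneg : Γ.NegDef) (hW : Admissible W) {ε : ℤ}
    (hε : ε = 1 ∨ ε = -1) (k : Γ.Spinc) :
    (Γ.weightedRoot ε k W).Isomorphic (μ.result.weightedRoot ε (μ.beta k) W) := by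
  have hm := fun i => μ.isComponentMap_superU hneg k i
  have hg := μ.gradesU_beta hneg k
  let f : (Γ.weightedRoot ε k W).Node ≃ (μ.result.weightedRoot ε (μ.beta k) W).Node :=
    { toFun := fun n => ⟨(n.1.1, μ.proj ⁻¹' n.1.2 ∩ (μ.beta k).superU n.1.1),
        hg.ge n.2.1, n.2.2.preimage (hm _)⟩
      invFun := fun n => ⟨(n.1.1, μ.proj '' n.1.2), hg.le n.2.1, n.2.2.image (hm _)⟩
      left_inv := fun n => Subtype.ext (Prod.ext rfl (n.2.2.image_preimage (hm _)))
      right_inv := fun n => Subtype.ext (Prod.ext rfl (n.2.2.preimage_image (hm _))) }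
  refine WeightedGradedGraph.isomorphic_of_equiv f rfl rfl (fun n m => ?_) (fun n => rfl)
    fun n => μ.componentWeight_result hneg hW hε k n.1.1 n.2.2.subset
  refine and_congr_right fun h => ?_
  have h' : m.1.1 ≤ n.1.1 := by
    have : m.1.1 = n.1.1 - 2 := h
    linarith
  exact n.2.2.preimage_subset_iff (hm _) (hm _) ((μ.beta k).superU_antitone h') m.2.2

theorem weightedBiroot_isomorphic (μ : Γ.Move) (hneg : Γ.NegDef) (hW : Admissible W) {ε : ℤ}
    (hε : ε = 1 ∨ ε = -1) (k : Γ.Spinc) :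
    (Γ.weightedBiroot ε k W).Isomorphic (μ.result.weightedBiroot ε (μ.beta k) W) := by
  have hm := fun i j => μ.isComponentMap_superUV hneg k i j
  have hg := μ.gradesU_beta hneg k
  have hg' := μ.gradesV_beta hneg k
  let f : (Γ.weightedBiroot ε k W).Node ≃ (μ.result.weightedBiroot ε (μ.beta k) W).Node :=
    { toFun := fun n =>
        ⟨(n.1.1, μ.proj ⁻¹' n.1.2 ∩ ((μ.beta k).superU n.1.1.1 ∩ (μ.beta k).superV n.1.1.2)),
          hg.ge n.2.1, hg'.ge n.2.2.1, n.2.2.2.preimage (hm _ _)⟩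
      invFun := fun n => ⟨(n.1.1, μ.proj '' n.1.2), hg.le n.2.1, hg'.le n.2.2.1,
        n.2.2.2.image (hm _ _)⟩
      left_inv := fun n => Subtype.ext (Prod.ext rfl (n.2.2.2.image_preimage (hm _ _)))
      right_inv := fun n => Subtype.ext (Prod.ext rfl (n.2.2.2.preimage_image (hm _ _))) }
  refine WeightedGradedGraph.isomorphic_of_equiv f rfl rfl (fun n m => ?_) (fun n => rfl)
    fun n => ?_
  · refine and_congr_right fun h => ?_
    have h' : m.1.1.1 ≤ n.1.1.1 ∧ m.1.1.2 ≤ n.1.1.2 := by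
      have : (m.1.1.1 = n.1.1.1 - 2 ∧ m.1.1.2 = n.1.1.2) ∨
        (m.1.1.1 = n.1.1.1 ∧ m.1.1.2 = n.1.1.2 - 2) := h
      rcases this with ⟨h1, h2⟩ | ⟨h1, h2⟩ <;> constructor <;> linarith
    exact n.2.2.2.preimage_subset_iff (hm _ _) (hm _ _)
      (Set.inter_subset_inter ((μ.beta k).superU_antitone h'.1)
        ((μ.beta k).superV_antitone h'.2)) m.2.2.2
  · have hU := μ.isComponentMap_superU hneg k n.1.1.1
    obtain ⟨hD, hCD⟩ := n.2.2.2.sUnion (T := k.superU n.1.1.1) Set.inter_subset_left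
    obtain ⟨hD', hCD'⟩ := (f n).2.2.2.sUnion (T := (μ.beta k).superU n.1.1.1)
      Set.inter_subset_left
    obtain ⟨K, hK⟩ := (f n).2.2.2.nonempty
    -- The component above that contains the preimage of the node and the preimage of the containing
    -- component below share the point `K`, so they coincide.
    have e := hD'.eq_of_mem (hD.preimage hU) (hCD' hK) ⟨hCD hK.1, hK.2.1⟩
    exact (congrArg _ e).trans (μ.componentWeight_result hneg hW hε k n.1.1.1 hD.subset)

end Move

end MarkedPlumbing

theorem theorem3p13 {V : Type*} [Fintype V] [DecidableEq V] (Γ : MarkedPlumbing V) (μ : Γ.Move)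
    (hneg : Γ.NegDef ∨ μ.result.NegDef) {R : Type*} [CommRing R] (W : ℕ → ℤ → R)
    (hW : Admissible W) (ε : ℤ) (hε : ε = 1 ∨ ε = -1) :
    (Γ.NegDef ∧ μ.result.NegDef) ∧ Function.Bijective μ.beta ∧
      ∀ k : Γ.Spinc,
        (Γ.weightedRoot ε k W).Isomorphic (μ.result.weightedRoot ε (μ.beta k) W) ∧
        (Γ.weightedBiroot ε k W).Isomorphic (μ.result.weightedBiroot ε (μ.beta k) W) := by
  have h : Γ.NegDef := hneg.elim id μ.negDef_result_iff.1
  exact ⟨⟨h, μ.negDef_result_iff.2 h⟩, μ.beta_bijective, fun k =>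
    ⟨μ.weightedRoot_isomorphic h hW hε k, μ.weightedBiroot_isomorphic h hW hε k⟩⟩
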